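/- Let $\ell\ge 1$ be an odd integer. For $n\ge 3$ let $S^{n-1}$ be the unit sphere of $\mathbb{R}^n$, and for $1\le k\le n$ define $p_\ell^{(k)}:S^{n-1}\to\mathbb{R}$ by $$p_\ell^{(k)}(x)=A\,C_\ell^{\frac{n-2}{2}}(x_k),\qquad A=\sqrt{\frac{(n-3)!\,\ell!\,(n+2\ell-2)}{(n+\ell-3)!\,(n-2)}},$$ where $$C_\ell^{\kappa}(t)=\frac{2^\ell}{\Gamma(\kappa)}\sum_{j=0}^{\lfloor \ell/2\rfloor}\frac{(-1)^j\,\Gamma(\kappa+\ell-j)}{2^{2j}\,j!\,(\ell-2j)!}\,t^{\ell-2j}$$ is the Gegenbauer polynomial. Let $X$ be uniformly distributed on $S^{n-1}$, let $Z$ be a standard Gaussian random variable on $\mathbb{R}$, and let $d_{TV}(U,V)=\sup_B|\mathbb{P}(U\in B)-\mathbb{P}(V\in B)|$, the supremum being over Borel sets $B\subseteq\mathbb{R}$. There are constants $c$ and $c'$ depending only on $\ell$ such that for every $n\ge 3$ the following hold. 1. The functions $p_\ell^{(1)},\dots,p_\ell^{(n)}$ are eigenfunctions of degree $\ell$ of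 the Laplacian on $S^{n-1}$, i.e. they are smooth, not identically zero, and satisfy $\Delta_{S^{n-1}}p_\ell^{(k)}=-\ell(n+\ell-2)\,p_\ell^{(k)}$; and they are orthonormal: $\mathbb{E}\big[p_\ell^{(i)}(X)\,p_\ell^{(j)}(X)\big]=\delta_{ij}$. 2. For all $a\in\mathbb{R}^n$ with $\sum_i a_i^2=1$, the function $p=\sum_{i=1}^n a_i\,p_\ell^{(i)}$ satisfies $$d_{TV}(p(X),Z)\le c\,\|a\|_4^2,\qquad \|a\|_4=\Big(\sum_i|a_i|^4\Big)^{1/4}.$$ 3. If the coefficient vector $a$ is random and uniformly distributed on $S^{n-1}$ (and independent of $X$, the distance $d_{TV}(p(X),Z)$ being taken for fixed $a$), then $$\mathbb{E}\,d_{TV}(p(X),Z)\le\frac{c'}{\sqrt n}.$$ -/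

import Mathlib

open MeasureTheory ProbabilityTheory
open scoped Nat ContDiff

noncomputable section

/-- The unit sphere `S^{n-1}` in Euclidean `ℝⁿ`. -/
abbrev UnitSphere (n : ℕ) : Type :=
  Metric.sphere (0 : EuclideanSpace ℝ (Fin n)) 1

/-- The uniform distribution on `S^{n-1}`: surface measure divided by the total surface area. -/
def uniformSphere (n : ℕ) : Measure (UnitSphere n) :=
  ((volume : Measure (EuclideanSpace ℝ (Fin n))).toSphere Set.univ)⁻¹ •
    (volume : Measure (EuclideanSpace ℝ (Fin n))).toSphere

/-- The total variation distance `sup_A |μ(A) - ν(A)|` of two probability measures on `ℝ`, the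
supremum being taken over the Borel sets `A`. For two real random variables it is applied to
their laws. -/
def tvDist (μ ν : Measure ℝ) : ℝ :=
  ⨆ A : {A : Set ℝ // MeasurableSet A}, |μ.real A.1 - ν.real A.1|

/-- The Gegenbauer polynomial `C^k_ℓ(t)`, for a parameter `k > 0`. -/
def gegenbauer (k : ℝ) (ℓ : ℕ) (t : ℝ) : ℝ :=
  2 ^ ℓ / Real.Gamma k *
    ∑ j ∈ Finset.range (ℓ / 2 + 1),
      (-1) ^ j * Real.Gamma (k + ℓ - j) / (2 ^ (2 * j) * (j ! : ℝ) * ((ℓ - 2 * j)! : ℝ)) *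
        t ^ (ℓ - 2 * j)

/-- The normalization constant `A`, for `n ≥ 3`. -/
def zonalConst (n ℓ : ℕ) : ℝ :=
  Real.sqrt (((n - 3)! : ℝ) * (ℓ ! : ℝ) * ((n : ℝ) + 2 * ℓ - 2) /
    (((n + ℓ - 3)! : ℝ) * ((n : ℝ) - 2)))

/-- The normalized zonal harmonic `p_ℓ^{(k)}(x) = A · C_ℓ^{(n-2)/2}(x_k)` on `S^{n-1}`. -/
def zonalHarmonic (n ℓ : ℕ) (k : Fin n) (x : UnitSphere n) : ℝ :=
  zonalConst n ℓ * gegenbauer (((n : ℝ) - 2) / 2) ℓ ((x : EuclideanSpace ℝ (Fin n)) k)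

/-- The linear combination `p = ∑ a_k p_ℓ^{(k)}`. -/
def zonalCombination (n ℓ : ℕ) (a : Fin n → ℝ) (x : UnitSphere n) : ℝ :=
  ∑ k, a k * zonalHarmonic n ℓ k x

/-- The extension of `f : S^{n-1} → ℝ` to `ℝⁿ ∖ {0}` that is constant along rays,
`y ↦ f (y / ‖y‖)` (with value `0` at the origin). -/
def radialExtension {n : ℕ} (f : UnitSphere n → ℝ) (y : EuclideanSpace ℝ (Fin n)) : ℝ :=
  if h : y = 0 then 0
  else f ⟨‖y‖⁻¹ • y, by
    rw [mem_sphere_zero_iff_norm, norm_smul, norm_inv, norm_norm,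
      inv_mul_cancel₀ (norm_ne_zero_iff.mpr h)]⟩

/-- The Laplace-Beltrami operator of the round sphere `S^{n-1}`: the Euclidean Laplacian of the
extension of `f` that is constant along rays, restricted to the sphere. -/
def sphereLaplacian {n : ℕ} (f : UnitSphere n → ℝ) (x : UnitSphere n) : ℝ :=
  Laplacian.laplacian (radialExtension f) (x : EuclideanSpace ℝ (Fin n))

/-- `f` is an eigenfunction of degree `ℓ` on `S^{n-1}`: a smooth, not identically zero function
with `Δ f = -ℓ (n + ℓ - 2) f`. -/
def IsSphereEigenfunction {n : ℕ} (ℓ : ℕ) (f : UnitSphere n → ℝ) : Prop :=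
  f ≠ 0 ∧ ContDiffOn ℝ ∞ (radialExtension f) {0}ᶜ ∧
    ∀ x, sphereLaplacian f x = -((ℓ : ℝ) * ((n : ℝ) + ℓ - 2)) * f x

/-- The norm `‖a‖₄ = (∑ |a_i|⁴)^{1/4}`. -/
def norm4 {n : ℕ} (a : Fin n → ℝ) : ℝ :=
  (∑ i, |a i| ^ 4) ^ ((1 : ℝ) / 4)

/-- `d_TV(p(X), Z)` for `p = ∑ a_k p_ℓ^{(k)}`, `X` uniform on `S^{n-1}` and `Z` standard
Gaussian. -/
def zonalTV (n ℓ : ℕ) (a : Fin n → ℝ) : ℝ :=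
  tvDist ((uniformSphere n).map (zonalCombination n ℓ a)) (gaussianReal 0 1)

end

/-! The proof is Stein's method for eigenfunctions. Let `f = ∑ a_k q(x_k)` with `q` the normalized
zonal polynomial, and `μ = ℓ(n+ℓ-2)`. Integration by parts gives `μ E[f g(f)] = E[|∇f|² g'(f)]`
(`integral_mul_comp_eq`). Taking for `g` a solution of the Stein equation with `|g'| ≤ 2`
(`exists_stein_solution`) bounds the total variation distance by `(2/μ) E|μ - |∇f|²|`
(`zonalTV_le_integral_gradSq`).

On the sphere `|∇f|² = ∑ a_j² q'(x_j)² - (∑ a_j x_j q'(x_j))²`, whose mean is exactly `μ` by the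
energy identity `momentFunctional_energy`. The second sum has bounded mean square: `X q'` is odd, so
cross terms vanish. The first sum has variance `O(n² ∑ a_j⁴) + O(n)`, because `q'(x_j)²` is of size
`n` and distinct coordinates have correlations of order `1/n` (`abs_pairMoment_sub_le`). By
Cauchy-Schwarz `n ∑ a_j⁴ ≥ 1`, so every error is `O(n ‖a‖₄²)` (`exists_integral_abs_sub_gradSq_le`);
division by `μ ≥ n/2` gives the second claim. The third follows from `E ∑ a_i⁴ ≤ 3/n`.

All integrals reduce to moments of one or two coordinates, and these come from rotation invariance
alone: differentiating along rotations yields the divergence theorem `integral_fderiv_tangential`,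
hence recursions for the moments. The norm of `C_ℓ^k` is found by induction on `ℓ`: energy identity,
derivative formula, and the fact that the weight `1 - t²` raises the dimension by two. The
eigenvalue equation is the Gegenbauer differential equation after a direct computation of the
Laplacian. -/

noncomputable section

/-! ### The uniform distribution on the sphere -/

/-- A linear isometry of `ℝⁿ` restricted to the unit sphere. -/
def sphereIsometry {n : ℕ} (e : EuclideanSpace ℝ (Fin n) ≃ₗᵢ[ℝ] EuclideanSpace ℝ (Fin n))
    (x : UnitSphere n) : UnitSphere n :=
  ⟨e x, by simp⟩

lemma measurable_sphereIsometry {n : ℕ}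
    (e : EuclideanSpace ℝ (Fin n) ≃ₗᵢ[ℝ] EuclideanSpace ℝ (Fin n)) :
    Measurable (sphereIsometry e) :=
  (e.continuous.comp continuous_subtype_val).measurable.subtype_mk

/-- Surface measure of a set is a multiple of the volume of the cone over it; isometries carry cones
to cones and preserve volume. -/
lemma measurePreserving_sphereIsometry {n : ℕ}
    (e : EuclideanSpace ℝ (Fin n) ≃ₗᵢ[ℝ] EuclideanSpace ℝ (Fin n)) :
    MeasurePreserving (sphereIsometry e) (uniformSphere n) (uniformSphere n) := by
  refine ⟨measurable_sphereIsometry e, ?_⟩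
  unfold uniformSphere
  rw [Measure.map_smul]
  congr 1
  ext s hs
  rw [Measure.map_apply (measurable_sphereIsometry e) hs, Measure.toSphere_apply' _ hs,
    Measure.toSphere_apply' _ (measurable_sphereIsometry e hs)]
  congr 1
  symm
  rw [← e.measurePreserving.measure_preimage_equiv (f := e.toMeasurableEquiv)]
  congr 1
  ext y
  simp only [Set.mem_smul, Set.mem_preimage, Set.mem_image, Subtype.exists, exists_and_right,
    exists_eq_right, LinearIsometryEquiv.coe_toMeasurableEquiv]
  constructor
  · rintro ⟨r, hr, z, ⟨hz, hz'⟩, h⟩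
    refine ⟨r, hr, e.symm z, ⟨by simpa using hz, ?_⟩, ?_⟩
    · simpa [sphereIsometry] using hz'
    · apply e.injective
      simp [h]
  · rintro ⟨r, hr, z, ⟨hz, hz'⟩, rfl⟩
    exact ⟨r, hr, e z, ⟨by simpa using hz, hz'⟩, by simp⟩

lemma isProbabilityMeasure_uniformSphere {n : ℕ} (hn : 0 < n) :
    IsProbabilityMeasure (uniformSphere n) := by
  have : Nonempty (Fin n) := ⟨⟨0, hn⟩⟩
  constructor
  unfold uniformSphere
  rw [Measure.smul_apply, smul_eq_mul]
  refine ENNReal.inv_mul_cancel ?_ (measure_ne_top _ _)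
  rw [Ne, Measure.measure_univ_eq_zero]
  exact Measure.toSphere_ne_zero _

instance {n : ℕ} : IsFiniteMeasure (uniformSphere n) := by
  rcases Nat.eq_zero_or_pos n with rfl | hn
  · have : IsEmpty (UnitSphere 0) := ⟨fun x => by
      have h : ‖(x : EuclideanSpace ℝ (Fin 0))‖ = 1 := by simp
      rw [Subsingleton.elim (x : EuclideanSpace ℝ (Fin 0)) 0] at h
      simp at h⟩
    exact ⟨by rw [Set.eq_empty_of_isEmpty Set.univ]; simp⟩
  · have := isProbabilityMeasure_uniformSphere hn
    infer_instance

lemma integrable_uniformSphere {n : ℕ} {f : UnitSphere n → ℝ} (hf : Continuous f) :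
    Integrable f (uniformSphere n) :=
  hf.integrable_of_hasCompactSupport (HasCompactSupport.of_compactSpace f)

lemma integrable_uniformSphere_coe {n : ℕ} {f : EuclideanSpace ℝ (Fin n) → ℝ}
    (hf : Continuous f) : Integrable (fun x : UnitSphere n => f x) (uniformSphere n) :=
  integrable_uniformSphere (hf.comp continuous_subtype_val)

lemma sum_sq_sphere {n : ℕ} (x : UnitSphere n) :
    ∑ i, (x : EuclideanSpace ℝ (Fin n)) i ^ 2 = 1 := by
  have h : ‖(x : EuclideanSpace ℝ (Fin n))‖ = 1 := by simp
  rw [EuclideanSpace.norm_eq, Real.sqrt_eq_one] at h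
  simpa using h

/-! ### Rotations in a coordinate plane -/

section rotation

variable {n : ℕ}

/-- The standard basis vector of `ℝⁿ`. -/
abbrev stdVec (i : Fin n) : EuclideanSpace ℝ (Fin n) := EuclideanSpace.single i 1

/-- Rotation by the angle `θ` in the plane of the coordinates `i` and `j`. -/
def planeRotation (i j : Fin n) (θ : ℝ) (x : EuclideanSpace ℝ (Fin n)) :
    EuclideanSpace ℝ (Fin n) :=
  x + ((Real.cos θ - 1) * x i - Real.sin θ * x j) • stdVec i +
    ((Real.cos θ - 1) * x j + Real.sin θ * x i) • stdVec j

lemma norm_planeRotation {i j : Fin n} (hij : i ≠ j) (θ : ℝ) (x : EuclideanSpace ℝ (Fin n)) :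
    ‖planeRotation i j θ x‖ = ‖x‖ := by
  rw [← sq_eq_sq₀ (norm_nonneg _) (norm_nonneg _), planeRotation, norm_add_sq_real,
    norm_add_sq_real]
  simp only [inner_add_left, inner_smul_left, inner_smul_right, norm_smul,
    EuclideanSpace.inner_single_right, PiLp.norm_single, PiLp.single_apply]
  simp [hij.symm]
  have := Real.sin_sq_add_cos_sq θ
  linear_combination (x i ^ 2 + x j ^ 2) * this

/-- `planeRotation` as a linear isometric equivalence. -/
def planeRotationEquiv {i j : Fin n} (hij : i ≠ j) (θ : ℝ) :
    EuclideanSpace ℝ (Fin n) ≃ₗᵢ[ℝ] EuclideanSpace ℝ (Fin n) :=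
  LinearIsometry.toLinearIsometryEquiv
    { toFun := planeRotation i j θ
      map_add' := fun x y => by
        simp only [planeRotation, PiLp.add_apply]
        module
      map_smul' := fun c x => by
        simp only [planeRotation, PiLp.smul_apply, smul_eq_mul, RingHom.id_apply]
        module
      norm_map' := norm_planeRotation hij θ } rfl

/-- Needed at every angle, not only at `0`: differentiation under the integral sign requires a
dominated derivative on a neighbourhood. -/
lemma hasDerivAt_planeRotation {i j : Fin n} (hij : i ≠ j) (θ : ℝ)
    (x : EuclideanSpace ℝ (Fin n)) :
    HasDerivAt (fun t => planeRotation i j t x)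
      (planeRotation i j θ x i • stdVec j - planeRotation i j θ x j • stdVec i) θ := by
  have h1 : HasDerivAt (fun t => (Real.cos t - 1) * x i - Real.sin t * x j)
      (-Real.sin θ * x i - Real.cos θ * x j) θ :=
    (((Real.hasDerivAt_cos θ).sub_const 1).mul_const _).sub
      ((Real.hasDerivAt_sin θ).mul_const _)
  have h2 : HasDerivAt (fun t => (Real.cos t - 1) * x j + Real.sin t * x i)
      (-Real.sin θ * x j + Real.cos θ * x i) θ :=
    (((Real.hasDerivAt_cos θ).sub_const 1).mul_const _).add
      ((Real.hasDerivAt_sin θ).mul_const _)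
  refine (((h1.smul_const (stdVec i)).const_add x).add
    (h2.smul_const (stdVec j))).congr_deriv ?_
  simp only [planeRotation, PiLp.add_apply, PiLp.smul_apply, PiLp.single_apply, smul_eq_mul, hij,
    hij.symm, if_true, if_false]
  module

/-- The integral over the sphere of the derivative of a `C¹` function along an infinitesimal
rotation vanishes. -/
lemma integral_fderiv_rotation {F : EuclideanSpace ℝ (Fin n) → ℝ} (hF : ContDiff ℝ 1 F)
    {i j : Fin n} (hij : i ≠ j) :
    ∫ x : UnitSphere n, fderiv ℝ F x ((x : EuclideanSpace ℝ (Fin n)) i • stdVec j -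
      (x : EuclideanSpace ℝ (Fin n)) j • stdVec i) ∂(uniformSphere n) = 0 := by
  set D : EuclideanSpace ℝ (Fin n) → ℝ := fun x => fderiv ℝ F x (x i • stdVec j - x j • stdVec i)
    with hD
  have hDc : Continuous D := by
    have := hF.continuous_fderiv one_ne_zero
    fun_prop
  have hder : ∀ (x : EuclideanSpace ℝ (Fin n)) (θ : ℝ),
      HasDerivAt (fun t => F (planeRotation i j t x)) (D (planeRotation i j θ x)) θ := fun x θ =>
    ((hF.differentiable one_ne_zero _).hasFDerivAt).comp_hasDerivAt θ
      (hasDerivAt_planeRotation hij θ x)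
  -- Rotated points stay on the sphere, so one compactness bound dominates the derivative for all
  -- angles.
  obtain ⟨C, hC⟩ : ∃ C, ∀ x ∈ Metric.sphere (0 : EuclideanSpace ℝ (Fin n)) 1, ‖D x‖ ≤ C :=
    (isCompact_sphere _ _).exists_bound_of_continuousOn hDc.continuousOn
  have hcont : ∀ θ, Continuous (fun x : UnitSphere n => planeRotation i j θ x) := fun θ =>
    (planeRotationEquiv hij θ).continuous.comp continuous_subtype_val
  have key := (hasDerivAt_integral_of_dominated_loc_of_deriv_le (μ := uniformSphere n)
    (F := fun t (x : UnitSphere n) => F (planeRotation i j t x))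
    (F' := fun t (x : UnitSphere n) => D (planeRotation i j t x)) (x₀ := 0) (bound := fun _ => C)
    (s := Set.univ) Filter.univ_mem
    (Filter.Eventually.of_forall fun θ =>
      (hF.continuous.comp (hcont θ)).aestronglyMeasurable)
    (integrable_uniformSphere (hF.continuous.comp (hcont 0)))
    (hDc.comp (hcont 0)).aestronglyMeasurable
    (Filter.Eventually.of_forall fun x θ _ => hC _ (by
      rw [mem_sphere_zero_iff_norm, norm_planeRotation hij]; simp))
    (integrable_const C) (Filter.Eventually.of_forall fun x θ _ => hder x θ)).2
  -- Rotation invariance makes the integral constant in `t`; comparing its two derivatives at `0`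
  -- gives the claim.
  have hconst : (fun t => ∫ x : UnitSphere n, F (planeRotation i j t x) ∂(uniformSphere n)) =
      fun _ => ∫ x : UnitSphere n, F x ∂(uniformSphere n) := by
    funext t
    have hmp := measurePreserving_sphereIsometry (planeRotationEquiv hij t)
    have h2 := integral_map (μ := uniformSphere n) hmp.measurable.aemeasurable
      (f := fun x : UnitSphere n => F x)
      (hF.continuous.comp continuous_subtype_val).aestronglyMeasurable
    rw [hmp.map_eq] at h2
    exact h2.symm
  rw [hconst] at key
  have h0 := key.unique (hasDerivAt_const _ _)
  simp only [planeRotation, Real.cos_zero, sub_self, zero_mul, Real.sin_zero, zero_smul,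
    add_zero] at h0
  exact h0

/-- The divergence theorem on the sphere for the tangential part of the constant vector field
`e_j`. -/
lemma integral_fderiv_tangential {F : EuclideanSpace ℝ (Fin n) → ℝ} (hF : ContDiff ℝ 1 F)
    (j : Fin n) :
    ∫ x : UnitSphere n, fderiv ℝ F x (stdVec j -
      (x : EuclideanSpace ℝ (Fin n)) j • (x : EuclideanSpace ℝ (Fin n))) ∂(uniformSphere n) =
      ((n : ℝ) - 1) *
        ∫ x : UnitSphere n, (x : EuclideanSpace ℝ (Fin n)) j * F x ∂(uniformSphere n) := by
  have hfd := hF.continuous_fderiv one_ne_zero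
  -- `T i` is the rotation derivative of `x_i F`. Summed over `i`, the rotation fields weighted by
  -- `x_i` give `e_j - x_j x` on the sphere, and the `n - 1` indices `i ≠ j` give the factor `n -
  -- 1`.
  set T : Fin n → EuclideanSpace ℝ (Fin n) → ℝ := fun i x =>
    (if i = j then 0 else - (x j * F x)) + x i * fderiv ℝ F x (x i • stdVec j - x j • stdVec i)
    with hT
  have hTc : ∀ i, Continuous (T i) := fun i => by
    have := hF.continuous
    by_cases h : i = j <;> simp only [hT, h, if_true, if_false] <;> fun_prop
  have hzero : ∀ i, ∫ x : UnitSphere n, T i x ∂(uniformSphere n) = 0 := by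
    intro i
    by_cases h : i = j
    · subst h; simp [hT]
    · have hG : ContDiff ℝ 1 (fun x : EuclideanSpace ℝ (Fin n) => x i * F x) := by fun_prop
      rw [← integral_fderiv_rotation hG h]
      congr 1
      ext x
      have h1 : HasFDerivAt (fun x : EuclideanSpace ℝ (Fin n) => x i)
          (EuclideanSpace.proj i : EuclideanSpace ℝ (Fin n) →L[ℝ] ℝ)
          (x : EuclideanSpace ℝ (Fin n)) :=
        (EuclideanSpace.proj i : EuclideanSpace ℝ (Fin n) →L[ℝ] ℝ).hasFDerivAt
      have h2 := h1.mul (hF.differentiable one_ne_zero x).hasFDerivAt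
      erw [h2.fderiv]
      simp [hT, h]
      ring
  have hsum : ∀ x : UnitSphere n, ∑ i, T i x = fderiv ℝ F x (stdVec j -
      (x : EuclideanSpace ℝ (Fin n)) j • (x : EuclideanSpace ℝ (Fin n))) -
      ((n : ℝ) - 1) * ((x : EuclideanSpace ℝ (Fin n)) j * F x) := by
    intro x
    have hv : (stdVec j - (x : EuclideanSpace ℝ (Fin n)) j • (x : EuclideanSpace ℝ (Fin n))) =
        ∑ i, (x : EuclideanSpace ℝ (Fin n)) i • ((x : EuclideanSpace ℝ (Fin n)) i • stdVec j -
          (x : EuclideanSpace ℝ (Fin n)) j • stdVec i) := by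
      have hb : ∑ i, (x : EuclideanSpace ℝ (Fin n)) i • stdVec i =
          (x : EuclideanSpace ℝ (Fin n)) := by
        ext k
        simp [Pi.single_apply]
      simp only [smul_sub, Finset.sum_sub_distrib, smul_smul, ← pow_two]
      rw [← Finset.sum_smul, sum_sq_sphere, one_smul]
      congr 1
      refine (congrArg ((x : EuclideanSpace ℝ (Fin n)) j • ·) hb).symm.trans ?_
      simp only [Finset.smul_sum]
      exact Finset.sum_congr rfl fun i _ => by rw [smul_smul, mul_comm]
    rw [hv, map_sum]
    simp only [hT, map_smul, smul_eq_mul, Finset.sum_add_distrib]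
    have hc : ∑ i, (if i = j then (0 : ℝ) else -((x : EuclideanSpace ℝ (Fin n)) j * F x)) =
        -(((n : ℝ) - 1) * ((x : EuclideanSpace ℝ (Fin n)) j * F x)) := by
      have : ∀ i, (if i = j then (0 : ℝ) else -((x : EuclideanSpace ℝ (Fin n)) j * F x)) =
          (if i = j then (x : EuclideanSpace ℝ (Fin n)) j * F x else 0) +
            -((x : EuclideanSpace ℝ (Fin n)) j * F x) := by
        intro i; split_ifs <;> ring
      simp only [this, Finset.sum_add_distrib]
      simp
      ring
    rw [hc]
    ring
  have h := integral_finsetSum (μ := uniformSphere n) Finset.univ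
    (fun i _ => integrable_uniformSphere_coe (hTc i))
  simp only [hzero, Finset.sum_const_zero] at h
  simp only [hsum] at h
  rw [integral_sub, integral_const_mul] at h
  · linarith
  · exact integrable_uniformSphere_coe (f := fun x => fderiv ℝ F x (stdVec j - x j • x))
      (by fun_prop)
  · have := hF.continuous
    exact integrable_uniformSphere_coe (f := fun x => ((n : ℝ) - 1) * (x j * F x)) (by fun_prop)

end rotation

/-! ### Moments of the coordinates -/

/-- The moments of one coordinate of a uniform point on `S^{N-1}`, given by their recursion in
which the dimension `N` may be any real number. -/
def sphereMoment (N : ℝ) : ℕ → ℝ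
  | 0 => 1
  | 1 => 0
  | m + 2 => (m + 1) / (N + m) * sphereMoment N m

/-- The mixed moments of two coordinates of a uniform point on `S^{n-1}`. -/
def pairMoment {n : ℕ} (i k : Fin n) (m l : ℕ) : ℝ :=
  ∫ x : UnitSphere n, (x : EuclideanSpace ℝ (Fin n)) i ^ m *
    (x : EuclideanSpace ℝ (Fin n)) k ^ l ∂(uniformSphere n)

section moments

variable {n : ℕ} {i k : Fin n}

lemma hasFDerivAt_coord (i : Fin n) (x : EuclideanSpace ℝ (Fin n)) :
    HasFDerivAt (fun x : EuclideanSpace ℝ (Fin n) => x i)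
      (EuclideanSpace.proj i : EuclideanSpace ℝ (Fin n) →L[ℝ] ℝ) x :=
  (EuclideanSpace.proj i : EuclideanSpace ℝ (Fin n) →L[ℝ] ℝ).hasFDerivAt

/-- The divergence theorem for the monomial of bidegree `(m, l)`; the radial part of its derivative
contributes `m + l` by homogeneity. For `m = 0` the truncated exponent `m - 1` is harmless, being
multiplied by `m`. -/
lemma pairMoment_succ (hik : i ≠ k) (m l : ℕ) :
    ((n : ℝ) - 1 + m + l) * pairMoment i k (m + 1) l = m * pairMoment i k (m - 1) l := by
  have hF : ContDiff ℝ 1 (fun x : EuclideanSpace ℝ (Fin n) => x i ^ m * x k ^ l) := by fun_prop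
  have h := integral_fderiv_tangential hF i
  have hd : ∀ x : UnitSphere n, fderiv ℝ (fun x : EuclideanSpace ℝ (Fin n) => x i ^ m * x k ^ l) x
      (stdVec i - (x : EuclideanSpace ℝ (Fin n)) i • (x : EuclideanSpace ℝ (Fin n))) =
      m * ((x : EuclideanSpace ℝ (Fin n)) i ^ (m - 1) *
        (x : EuclideanSpace ℝ (Fin n)) k ^ l) -
      (m + l) * ((x : EuclideanSpace ℝ (Fin n)) i ^ (m + 1) *
        (x : EuclideanSpace ℝ (Fin n)) k ^ l) := by
    intro x
    have h2 := ((hasFDerivAt_coord i (x : EuclideanSpace ℝ (Fin n))).pow m).mul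
      ((hasFDerivAt_coord k (x : EuclideanSpace ℝ (Fin n))).pow l)
    erw [h2.fderiv]
    rcases m with _ | m <;> rcases l with _ | l <;> simp [hik] <;> ring
  simp only [hd] at h
  rw [integral_sub, integral_const_mul, integral_const_mul] at h
  · have e : ∀ x : UnitSphere n, (x : EuclideanSpace ℝ (Fin n)) i *
        ((x : EuclideanSpace ℝ (Fin n)) i ^ m * (x : EuclideanSpace ℝ (Fin n)) k ^ l) =
        (x : EuclideanSpace ℝ (Fin n)) i ^ (m + 1) * (x : EuclideanSpace ℝ (Fin n)) k ^ l :=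
      fun x => by ring
    simp only [e] at h
    unfold pairMoment
    linarith
  · exact integrable_uniformSphere_coe (f := fun x => m * (x i ^ (m - 1) * x k ^ l)) (by fun_prop)
  · exact integrable_uniformSphere_coe (f := fun x => ((m : ℝ) + l) * (x i ^ (m + 1) * x k ^ l))
      (by fun_prop)

lemma pairMoment_comm (i k : Fin n) (m l : ℕ) : pairMoment i k m l = pairMoment k i l m := by
  simp only [pairMoment, mul_comm]

lemma two_le_of_ne (hik : i ≠ k) : (2 : ℝ) ≤ n := by
  have : 1 < Fintype.card (Fin n) := Fintype.one_lt_card_iff.mpr ⟨i, k, hik⟩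
  rw [Fintype.card_fin] at this
  exact_mod_cast this

lemma pairMoment_add_two (hik : i ≠ k) (m l : ℕ) :
    pairMoment i k (m + 2) l = (m + 1) / (n + m + l) * pairMoment i k m l := by
  have h := pairMoment_succ hik (m + 1) l
  have hn := two_le_of_ne hik
  have : (0 : ℝ) < n + m + l := by positivity
  rw [div_mul_eq_mul_div, eq_div_iff this.ne']
  rw [Nat.add_sub_cancel] at h
  push_cast at h
  linear_combination h

lemma pairMoment_one (hik : i ≠ k) (l : ℕ) : pairMoment i k 1 l = 0 := by
  have h := pairMoment_succ hik 0 l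
  have hn := two_le_of_ne hik
  have : (0 : ℝ) < n - 1 + l := by have : (0 : ℝ) ≤ l := by positivity
                                   linarith
  simpa [this.ne'] using h

lemma pairMoment_odd (hik : i ≠ k) {m : ℕ} (hm : Odd m) (l : ℕ) : pairMoment i k m l = 0 := by
  obtain ⟨r, rfl⟩ := hm
  induction r with
  | zero => exact pairMoment_one hik l
  | succ r ih =>
    rw [show 2 * (r + 1) + 1 = (2 * r + 1) + 2 by ring, pairMoment_add_two hik, ih, mul_zero]

lemma pairMoment_zero_right (hik : i ≠ k) (m : ℕ) : pairMoment i k m 0 = sphereMoment n m := by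
  induction m using Nat.twoStepInduction with
  | zero =>
    have := two_le_of_ne hik
    have := isProbabilityMeasure_uniformSphere (n := n)
      (by exact_mod_cast (by linarith : (0 : ℝ) < n))
    simp [pairMoment, sphereMoment]
  | one => rw [pairMoment_one hik, sphereMoment]
  | more m ih _ => simp [pairMoment_add_two hik, ih, sphereMoment]

lemma sphereMoment_nonneg {N : ℝ} (hN : 0 < N) (m : ℕ) : 0 ≤ sphereMoment N m := by
  induction m using Nat.twoStepInduction with
  | zero => simp [sphereMoment]
  | one => simp [sphereMoment]
  | more m ih _ => rw [sphereMoment]; positivity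

/-- After scaling by `√N` the recursion has factor `(m+1) N/(N+m) ≤ m+1`, so the growth is at most
that of Gaussian moments. -/
lemma sphereMoment_le {N : ℝ} (hN : 0 < N) (m : ℕ) :
    √N ^ m * sphereMoment N m ≤ (m ! : ℝ) := by
  induction m using Nat.twoStepInduction with
  | zero => simp [sphereMoment]
  | one => simp [sphereMoment]
  | more m ih _ =>
    have h0 := sphereMoment_nonneg hN m
    calc √N ^ (m + 2) * sphereMoment N (m + 2)
        = N / (N + m) * ((m + 1) * (√N ^ m * sphereMoment N m)) := by
          rw [sphereMoment, pow_add, Real.sq_sqrt hN.le]; ring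
      _ ≤ 1 * ((m + 1) * (m ! : ℝ)) := by
          gcongr
          exact div_le_one_of_le₀ (by linarith [Nat.cast_nonneg (α := ℝ) m]) (by positivity)
      _ ≤ ((m + 2)! : ℝ) := by
          rw [Nat.factorial_succ, Nat.factorial_succ]
          push_cast
          have : (0 : ℝ) < (m ! : ℝ) := by positivity
          nlinarith [mul_pos (by positivity : (0 : ℝ) < (m : ℝ) + 1) this]

/-- Distinct coordinates are asymptotically uncorrelated. -/
lemma abs_pairMoment_sub_le (hik : i ≠ k) (m l : ℕ) :
    n * √n ^ (m + l) * |pairMoment i k m l - sphereMoment n m * sphereMoment n l| ≤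
      m * l * (m ! * l !) := by
  have hn2 := two_le_of_ne hik
  have hn : (0 : ℝ) < n := by linarith
  induction m using Nat.twoStepInduction with
  | zero =>
    rw [pairMoment_comm, pairMoment_zero_right hik.symm]
    simp [sphereMoment]
  | one =>
    simp [pairMoment_one hik, sphereMoment]
    positivity
  | more m ih _ =>
    set P := pairMoment i k m l
    set a := sphereMoment (n : ℝ) m with ha
    set b := sphereMoment (n : ℝ) l with hb
    have ha0 : 0 ≤ a := sphereMoment_nonneg hn m
    have hb0 : 0 ≤ b := sphereMoment_nonneg hn l
    have ha1 := sphereMoment_le hn m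
    have hb1 := sphereMoment_le hn l
    have hD : (0 : ℝ) < n + m + l := by positivity
    -- The recursion factors of the mixed and the single moment have denominators `n+m+l` and `n+m`.
    -- Their difference, of order `1/n²`, is the only source of correlation.
    have e1 : pairMoment i k (m + 2) l - sphereMoment n (m + 2) * b =
        (m + 1) / (n + m + l) * (P - a * b) - (m + 1) * (a * b) * (l / ((n + m) * (n + m + l))) := by
      rw [pairMoment_add_two hik, sphereMoment]
      simp only [← ha]
      field_simp
      ring
    have h1 : |pairMoment i k (m + 2) l - sphereMoment n (m + 2) * b| ≤
        (m + 1) / n * |P - a * b| + (m + 1) * (a * b) * (l / (n * n)) := by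
      rw [e1]
      refine (abs_sub _ _).trans ?_
      rw [abs_mul, abs_of_nonneg (by positivity : (0 : ℝ) ≤ (m + 1) / (n + m + l)),
        abs_of_nonneg (by positivity :
          (0 : ℝ) ≤ (m + 1) * (a * b) * (l / ((n + m) * (n + m + l))))]
      have hm0 : (0 : ℝ) ≤ m := by positivity
      have hl0 : (0 : ℝ) ≤ l := by positivity
      gcongr <;> linarith
    calc n * √n ^ (m + 2 + l) * |pairMoment i k (m + 2) l - sphereMoment n (m + 2) * b|
        ≤ n * √n ^ (m + 2 + l) *
          ((m + 1) / n * |P - a * b| + (m + 1) * (a * b) * (l / (n * n))) := by gcongr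
      _ = (m + 1) * (n * √n ^ (m + l) * |P - a * b|) +
          (m + 1) * l * ((√n ^ m * a) * (√n ^ l * b)) := by
        rw [show m + 2 + l = (m + l) + 2 by ring, pow_add _ _ 2, Real.sq_sqrt hn.le, pow_add]
        field_simp
      _ ≤ (m + 1) * (m * l * (m ! * l !)) + (m + 1) * l * (m ! * l !) := by gcongr
      _ = (m + 1) * ((m + 1) * m !) * l * l ! := by ring
      _ ≤ (m + 2) * ((m + 2) * ((m + 1) * m !)) * l * l ! := by
        have : (0 : ℝ) ≤ m := by positivity
        have : (0 : ℝ) ≤ m * m ! := by positivity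
        gcongr <;> linarith
      _ = ((m + 2 : ℕ) : ℝ) * l * ((m + 2)! * l !) := by
        rw [Nat.factorial_succ, Nat.factorial_succ]
        push_cast
        ring

end moments

/-! ### Integration of polynomials in the coordinates -/

section polynomials

open Polynomial

/-- Integration of a polynomial in one coordinate over `S^{N-1}`, for real `N`. -/
def momentFunctional (N : ℝ) : ℝ[X] →ₗ[ℝ] ℝ :=
  Polynomial.lsum fun m => sphereMoment N m • LinearMap.id

lemma momentFunctional_monomial (N : ℝ) (m : ℕ) (c : ℝ) :
    momentFunctional N (monomial m c) = c * sphereMoment N m := by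
  simp [momentFunctional, Polynomial.lsum_apply, mul_comm]

lemma momentFunctional_eq_sum (N : ℝ) (p : ℝ[X]) {d : ℕ} (hd : p.natDegree < d) :
    momentFunctional N p = ∑ m ∈ Finset.range d, p.coeff m * sphereMoment N m := by
  conv_lhs => rw [p.as_sum_range' d hd]
  simp [momentFunctional_monomial]

lemma integral_eval_mul_eval {n : ℕ} (i k : Fin n) (p r : ℝ[X]) {d e : ℕ}
    (hd : p.natDegree < d) (he : r.natDegree < e) :
    ∫ x : UnitSphere n, p.eval ((x : EuclideanSpace ℝ (Fin n)) i) *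
      r.eval ((x : EuclideanSpace ℝ (Fin n)) k) ∂(uniformSphere n) =
      ∑ m ∈ Finset.range d, ∑ l ∈ Finset.range e, p.coeff m * r.coeff l * pairMoment i k m l := by
  have h : ∀ x : UnitSphere n, p.eval ((x : EuclideanSpace ℝ (Fin n)) i) *
      r.eval ((x : EuclideanSpace ℝ (Fin n)) k) = ∑ m ∈ Finset.range d, ∑ l ∈ Finset.range e,
        p.coeff m * r.coeff l * ((x : EuclideanSpace ℝ (Fin n)) i ^ m *
          (x : EuclideanSpace ℝ (Fin n)) k ^ l) := by
    intro x
    rw [eval_eq_sum_range' hd, eval_eq_sum_range' he, Finset.sum_mul_sum]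
    refine Finset.sum_congr rfl fun m _ => Finset.sum_congr rfl fun l _ => by ring
  simp only [h]
  have hint : ∀ m l, Integrable (fun x : UnitSphere n => p.coeff m * r.coeff l *
      ((x : EuclideanSpace ℝ (Fin n)) i ^ m * (x : EuclideanSpace ℝ (Fin n)) k ^ l))
      (uniformSphere n) := fun m l => integrable_uniformSphere_coe
        (f := fun x => p.coeff m * r.coeff l * (x i ^ m * x k ^ l)) (by fun_prop)
  rw [integral_finsetSum _ fun m _ => integrable_finsetSum _ fun l _ => hint m l]
  refine Finset.sum_congr rfl fun m _ => ?_
  rw [integral_finsetSum _ fun l _ => hint m l]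
  refine Finset.sum_congr rfl fun l _ => ?_
  rw [integral_const_mul, pairMoment]

lemma integral_eval {n : ℕ} (hn : 2 ≤ n) (i : Fin n) (p : ℝ[X]) :
    ∫ x : UnitSphere n, p.eval ((x : EuclideanSpace ℝ (Fin n)) i) ∂(uniformSphere n) =
      momentFunctional n p := by
  have : Nontrivial (Fin n) := Fin.nontrivial_iff_two_le.mpr hn
  obtain ⟨k, hk⟩ := exists_ne i
  -- The second coordinate carries only the constant polynomial; its existence is where `2 ≤ n` is
  -- used.
  have h := integral_eval_mul_eval i k p 1 (Nat.lt_succ_self _)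
    (show (1 : ℝ[X]).natDegree < 1 by simp)
  simpa [momentFunctional_eq_sum _ p (Nat.lt_succ_self _), pairMoment_zero_right hk.symm] using h

/-- Odd moments in one coordinate vanish whatever power of another coordinate accompanies them, so
nothing is asked of `r`. -/
lemma integral_eval_mul_eval_of_odd {n : ℕ} {i k : Fin n} (hik : i ≠ k) (p r : ℝ[X])
    (hp : ∀ m, Even m → p.coeff m = 0) :
    ∫ x : UnitSphere n, p.eval ((x : EuclideanSpace ℝ (Fin n)) i) *
      r.eval ((x : EuclideanSpace ℝ (Fin n)) k) ∂(uniformSphere n) = 0 := by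
  rw [integral_eval_mul_eval i k p r (Nat.lt_succ_self _) (Nat.lt_succ_self _)]
  refine Finset.sum_eq_zero fun m _ => Finset.sum_eq_zero fun l _ => ?_
  rcases Nat.even_or_odd m with hm | hm
  · simp [hp m hm]
  · simp [pairMoment_odd hik hm]

/-- Integration by parts for `momentFunctional`. -/
lemma momentFunctional_derivative {N : ℝ} (hN : 0 < N) (p : ℝ[X]) :
    momentFunctional N ((1 - X ^ 2) * derivative p) = (N - 1) * momentFunctional N (X * p) := by
  induction p using Polynomial.induction_on' with
  | add p q hp hq => simp only [mul_add, map_add, hp, hq]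
  | monomial m c =>
    rw [derivative_monomial, sub_mul, one_mul, X_pow_mul_monomial, X_mul_monomial, map_sub,
      momentFunctional_monomial, momentFunctional_monomial, momentFunctional_monomial]
    rcases m with _ | m
    · simp [sphereMoment]
    · have : N + m ≠ 0 := by positivity
      simp only [Nat.add_sub_cancel, sphereMoment]
      field_simp
      push_cast
      ring

/-- One coordinate on `S^{N-1}` has density proportional to `(1 - t²)^{(N-3)/2}`; the weight `1 -
t²` therefore passes from `N` to `N + 2`. This is the moment form of that fact, valid for real `N`.
-/
lemma sphereMoment_add_two_dim {N : ℝ} (hN : 0 < N) (m : ℕ) :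
    (N + m) * sphereMoment (N + 2) m = N * sphereMoment N m := by
  induction m using Nat.twoStepInduction with
  | zero => simp [sphereMoment]
  | one => simp [sphereMoment]
  | more m ih _ =>
    have h1 : N + m ≠ 0 := by positivity
    have h2 : N + 2 + m ≠ 0 := by positivity
    simp only [sphereMoment]
    field_simp
    push_cast
    linear_combination (N + 2 + m) * ih

/-- The constant is the mean of `1 - t²` in dimension `N`. -/
lemma momentFunctional_add_two_dim {N : ℝ} (hN : 0 < N) (p : ℝ[X]) :
    momentFunctional N ((1 - X ^ 2) * p) = (N - 1) / N * momentFunctional (N + 2) p := by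
  induction p using Polynomial.induction_on' with
  | add p q hp hq => simp only [mul_add, map_add, hp, hq]
  | monomial m c =>
    rw [sub_mul, one_mul, X_pow_mul_monomial, map_sub,
      momentFunctional_monomial, momentFunctional_monomial, momentFunctional_monomial,
      sphereMoment]
    have h1 : N + m ≠ 0 := by positivity
    have h := sphereMoment_add_two_dim hN m
    have h3 : sphereMoment (N + 2) m = N * sphereMoment N m / (N + m) := by
      field_simp; linarith
    rw [h3]
    field_simp
    ring

end polynomials

/-! ### Gegenbauer polynomials -/

section gegenbauer

open Polynomial

/-- The coefficient of `t^{ℓ-2j}` in `C^k_ℓ(t)`. -/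
def gegenbauerCoeff (k : ℝ) (ℓ j : ℕ) : ℝ :=
  2 ^ ℓ / Real.Gamma k *
    ((-1) ^ j * Real.Gamma (k + ℓ - j) / (2 ^ (2 * j) * (j ! : ℝ) * ((ℓ - 2 * j)! : ℝ)))

/-- `C^k_ℓ` as a polynomial. -/
def gegenbauerPoly (k : ℝ) (ℓ : ℕ) : ℝ[X] :=
  ∑ j ∈ Finset.range (ℓ / 2 + 1), monomial (ℓ - 2 * j) (gegenbauerCoeff k ℓ j)

lemma eval_gegenbauerPoly (k : ℝ) (ℓ : ℕ) (t : ℝ) :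
    (gegenbauerPoly k ℓ).eval t = gegenbauer k ℓ t := by
  simp only [gegenbauerPoly, gegenbauerCoeff, gegenbauer, eval_finsetSum, eval_monomial,
    Finset.mul_sum, mul_assoc]

lemma natDegree_gegenbauerPoly_le (k : ℝ) (ℓ : ℕ) : (gegenbauerPoly k ℓ).natDegree ≤ ℓ :=
  natDegree_sum_le_of_forall_le _ _ fun _ _ => (natDegree_monomial_le _).trans (Nat.sub_le _ _)

/-- Writing the degree as `m + 2 * j` avoids truncated subtraction and singles out one summand. -/
lemma coeff_gegenbauerPoly (k : ℝ) (m j : ℕ) :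
    (gegenbauerPoly k (m + 2 * j)).coeff m = gegenbauerCoeff k (m + 2 * j) j := by
  rw [gegenbauerPoly, finsetSum_coeff, Finset.sum_eq_single j]
  · simp
  · intro b hb hbj
    rw [Finset.mem_range] at hb
    rw [coeff_monomial, if_neg (by omega)]
  · intro h
    rw [Finset.mem_range] at h
    omega

lemma coeff_gegenbauerPoly_eq_zero (k : ℝ) {ℓ m : ℕ} (h : ∀ j, ℓ ≠ m + 2 * j) :
    (gegenbauerPoly k ℓ).coeff m = 0 := by
  rw [gegenbauerPoly, finsetSum_coeff]
  refine Finset.sum_eq_zero fun j hj => ?_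
  rw [Finset.mem_range] at hj
  have := h j
  rw [coeff_monomial, if_neg (by omega)]

/-- Consecutive Gamma values differ by the factor `k + m + j + 1`. The result is the two-step
recursion that the differential equation imposes on coefficients. -/
lemma gegenbauerCoeff_succ {k : ℝ} (hk : 0 < k) (m j : ℕ) :
    4 * (j + 1) * (k + m + j + 1) * gegenbauerCoeff k (m + 2 * (j + 1)) (j + 1) =
      -((m + 2) * (m + 1)) * gegenbauerCoeff k (m + 2 + 2 * j) j := by
  have e : m + 2 * (j + 1) = m + 2 + 2 * j := by ring
  have hG : Real.Gamma (k + ((m + 2 + 2 * j : ℕ) : ℝ) - j) =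
      (k + m + j + 1) * Real.Gamma (k + ((m + 2 + 2 * j : ℕ) : ℝ) - (j + 1 : ℕ)) := by
    have e1 : k + ((m + 2 + 2 * j : ℕ) : ℝ) - (j + 1 : ℕ) = k + m + j + 1 := by push_cast; ring
    rw [e1, ← Real.Gamma_add_one (by positivity)]
    push_cast
    ring_nf
  have hGk : Real.Gamma k ≠ 0 := (Real.Gamma_pos_of_pos hk).ne'
  unfold gegenbauerCoeff
  rw [e, hG, Nat.add_sub_cancel, show m + 2 + 2 * j - 2 * (j + 1) = m by omega,
    Nat.factorial_succ (m + 1), Nat.factorial_succ m, Nat.factorial_succ j]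
  have := Nat.cast_ne_zero (R := ℝ).mpr (Nat.factorial_ne_zero m)
  have := Nat.cast_ne_zero (R := ℝ).mpr (Nat.factorial_ne_zero j)
  push_cast
  field_simp
  ring

/-- Lowering the degree raises the parameter by one, hence the dimension `2k + 2` by two, matching
`momentFunctional_add_two_dim`. -/
lemma derivative_gegenbauerPoly {k : ℝ} (hk : 0 < k) (ℓ : ℕ) :
    derivative (gegenbauerPoly k (ℓ + 1)) = C (2 * k) * gegenbauerPoly (k + 1) ℓ := by
  have hGk : Real.Gamma k ≠ 0 := (Real.Gamma_pos_of_pos hk).ne'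
  unfold gegenbauerPoly
  rw [derivative_sum, Finset.mul_sum]
  symm
  -- For odd `ℓ` the left sum has one more term, the constant one, which the derivative kills.
  refine Finset.sum_subset_zero_on_sdiff ?_ ?_ ?_
  · exact Finset.range_mono (by omega)
  · intro j hj
    rw [Finset.mem_sdiff, Finset.mem_range, Finset.mem_range] at hj
    rw [derivative_monomial, show ℓ + 1 - 2 * j = 0 by omega]
    simp
  · intro j hj
    rw [Finset.mem_range] at hj
    obtain ⟨r, rfl⟩ : ∃ r, ℓ = 2 * j + r := ⟨ℓ - 2 * j, by omega⟩
    rw [derivative_monomial, C_mul_monomial, show 2 * j + r + 1 - 2 * j = r + 1 by omega,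
      show 2 * j + r - 2 * j = r by omega, Nat.add_sub_cancel]
    congr 1
    unfold gegenbauerCoeff
    rw [show 2 * j + r + 1 - 2 * j = r + 1 by omega,
      show 2 * j + r - 2 * j = r by omega, Nat.factorial_succ, Real.Gamma_add_one hk.ne']
    have := Nat.cast_ne_zero (R := ℝ).mpr (Nat.factorial_ne_zero r)
    have := Nat.cast_ne_zero (R := ℝ).mpr (Nat.factorial_ne_zero j)
    have e : k + ((2 * j + r + 1 : ℕ) : ℝ) - j = k + 1 + ((2 * j + r : ℕ) : ℝ) - j := by
      push_cast; ring
    rw [e]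
    push_cast
    field_simp
    ring

/-- The Gegenbauer differential equation. -/
lemma gegenbauerPoly_ode {k : ℝ} (hk : 0 < k) (ℓ : ℕ) :
    (1 - X ^ 2) * derivative (derivative (gegenbauerPoly k ℓ)) -
      C (2 * k + 1) * (X * derivative (gegenbauerPoly k ℓ)) =
      -(C (ℓ * (ℓ + 2 * k)) * gegenbauerPoly k ℓ) := by
  set p := gegenbauerPoly k ℓ with hp
  -- The differential equation read off at `t^m`. At `m = ℓ` the factor `ℓ - m` vanishes; off the
  -- parity class, or above `ℓ`, both coefficients are zero.
  have key : ∀ m : ℕ, ((m : ℝ) + 2) * (m + 1) * p.coeff (m + 2) +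
      (ℓ - m) * (ℓ + m + 2 * k) * p.coeff m = 0 := by
    intro m
    by_cases h : ∃ j, ℓ = m + 2 * j
    · obtain ⟨j, rfl⟩ := h
      rcases j with _ | j
      · rw [hp, coeff_gegenbauerPoly_eq_zero k (m := m + 2) (fun j => by omega)]
        simp
      · have h1 : p.coeff m = gegenbauerCoeff k (m + 2 * (j + 1)) (j + 1) :=
          coeff_gegenbauerPoly k m (j + 1)
        have h2 : p.coeff (m + 2) = gegenbauerCoeff k (m + 2 + 2 * j) j := by
          rw [hp, show m + 2 * (j + 1) = m + 2 + 2 * j by ring]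
          exact coeff_gegenbauerPoly k (m + 2) j
        have h3 := gegenbauerCoeff_succ hk m j
        rw [h1, h2]
        push_cast
        linear_combination h3
    · push Not at h
      rw [hp, coeff_gegenbauerPoly_eq_zero k h,
        coeff_gegenbauerPoly_eq_zero k (m := m + 2) (fun j hj => h (j + 1) (by omega))]
      simp
  ext m
  rw [sub_mul, one_mul, coeff_sub, coeff_sub, coeff_neg, coeff_C_mul, coeff_C_mul]
  have hk := key m
  have hX2 : ∀ r : ℝ[X], ∀ m, (X ^ 2 * r).coeff (m + 2) = r.coeff m :=
    fun r m => coeff_X_pow_mul r 2 m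
  rcases m with _ | _ | m
  · rw [coeff_X_mul_zero, coeff_X_pow_mul', if_neg (by norm_num), coeff_derivative,
      coeff_derivative]
    push_cast at hk ⊢
    linear_combination hk
  · rw [coeff_X_mul, coeff_X_pow_mul', if_neg (by norm_num), coeff_derivative,
      coeff_derivative, coeff_derivative]
    push_cast at hk ⊢
    linear_combination hk
  · rw [coeff_X_mul, hX2, coeff_derivative, coeff_derivative, coeff_derivative, coeff_derivative]
    push_cast at hk ⊢
    linear_combination hk

/-- The energy identity for polynomial solutions of the ultraspherical differential equation. -/
lemma momentFunctional_energy {N μ : ℝ} (hN : 0 < N) {p : ℝ[X]}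
    (hp : (1 - X ^ 2) * derivative (derivative p) - C (N - 1) * (X * derivative p) =
      -(C μ * p)) :
    momentFunctional N ((1 - X ^ 2) * derivative p ^ 2) = μ * momentFunctional N (p ^ 2) := by
  -- Integration by parts for `p' p`: the equation replaces `p'' p`, and its first-order term
  -- cancels the right side.
  have h := momentFunctional_derivative hN (derivative p * p)
  have e1 : (1 - X ^ 2) * derivative (derivative p * p) =
      (1 - X ^ 2) * derivative p ^ 2 + C (N - 1) * (X * (derivative p * p)) - C μ * p ^ 2 := by
    rw [derivative_mul]
    linear_combination p * hp
  rw [e1, map_sub, map_add, ← smul_eq_C_mul, ← smul_eq_C_mul, map_smul, map_smul] at h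
  simp only [smul_eq_mul] at h
  linarith

/-- Induction on `ℓ` with the parameter free: the energy identity turns the square of `C_ℓ^k` into
the weighted square of its derivative, which is the square of `C_{ℓ-1}^{k+1}` two dimensions higher.
-/
lemma momentFunctional_gegenbauerPoly_sq (ℓ : ℕ) {k : ℝ} (hk : 0 < k) :
    momentFunctional (2 * k + 2) (gegenbauerPoly k ℓ ^ 2) =
      k / (ℓ + k) * (Real.Gamma (2 * k + ℓ) / (Real.Gamma (2 * k) * ℓ !)) := by
  induction ℓ generalizing k with
  | zero =>
    have h1 : Real.Gamma k ≠ 0 := (Real.Gamma_pos_of_pos hk).ne'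
    have h2 : Real.Gamma (2 * k) ≠ 0 := (Real.Gamma_pos_of_pos (by positivity)).ne'
    have : gegenbauerPoly k 0 = 1 := by
      have h0 : gegenbauerCoeff k 0 0 = 1 := by simp [gegenbauerCoeff, h1]
      simp [gegenbauerPoly, h0]
    rw [this, one_pow]
    have h3 : momentFunctional (2 * k + 2) 1 = 1 := by
      rw [← monomial_zero_one, momentFunctional_monomial]; simp [sphereMoment]
    rw [h3]
    simp [h2, hk.ne']
  | succ ℓ ih =>
    have hode := gegenbauerPoly_ode hk (ℓ + 1)
    have h1 := momentFunctional_energy (N := 2 * k + 2) (by positivity)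
      (μ := ((ℓ + 1 : ℕ) : ℝ) * ((ℓ + 1 : ℕ) + 2 * k)) (p := gegenbauerPoly k (ℓ + 1)) (by
        rw [← hode]; ring_nf)
    rw [momentFunctional_add_two_dim (by positivity), derivative_gegenbauerPoly hk, mul_pow,
      ← C_pow, ← smul_eq_C_mul, map_smul, show 2 * k + 2 + 2 = 2 * (k + 1) + 2 by ring,
      ih (by positivity)] at h1
    have hG : Real.Gamma (2 * (k + 1)) = (2 * k + 1) * (2 * k * Real.Gamma (2 * k)) := by
      rw [← Real.Gamma_add_one (by positivity), ← Real.Gamma_add_one (by positivity)]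
      ring_nf
    have hG2 : Real.Gamma (2 * (k + 1) + ℓ) =
        (2 * k + (ℓ + 1)) * Real.Gamma (2 * k + (ℓ + 1 : ℕ)) := by
      push_cast
      rw [← Real.Gamma_add_one (by positivity)]
      ring_nf
    have h2 : Real.Gamma (2 * k) ≠ 0 := (Real.Gamma_pos_of_pos (by positivity)).ne'
    rw [hG, hG2] at h1
    have hm : ((ℓ + 1 : ℕ) : ℝ) * ((ℓ + 1 : ℕ) + 2 * k) ≠ 0 := by positivity
    apply mul_left_cancel₀ hm
    rw [← h1, Nat.factorial_succ, smul_eq_mul]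
    have := Nat.cast_ne_zero (R := ℝ).mpr (Nat.factorial_ne_zero ℓ)
    have h4 : (ℓ : ℝ) + (k + 1) ≠ 0 := by positivity
    have h5 : (ℓ : ℝ) + 1 + k ≠ 0 := by positivity
    push_cast
    field_simp
    ring

lemma Gamma_add_nat_le {k : ℝ} (hk : 0 < k) (r : ℕ) :
    Real.Gamma (k + r) ≤ (k + r) ^ r * Real.Gamma k := by
  induction r with
  | zero => simp
  | succ r ih =>
    have hG := (Real.Gamma_pos_of_pos hk).le
    calc Real.Gamma (k + (r + 1 : ℕ)) = (k + r) * Real.Gamma (k + r) := by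
          rw [← Real.Gamma_add_one (by positivity)]; push_cast; ring_nf
      _ ≤ (k + (r + 1 : ℕ)) * ((k + (r + 1 : ℕ)) ^ r * Real.Gamma k) := by
          have : (r : ℝ) ≤ (r + 1 : ℕ) := by push_cast; linarith
          gcongr
          exact ih.trans (by gcongr)
      _ = _ := by ring

/-- The Gamma quotient is a product of `m + j` factors, each at most `k + m + j`; the factorials in
the denominator are simply dropped. -/
lemma abs_gegenbauerCoeff_le {k : ℝ} (hk : 0 < k) (m j : ℕ) :
    |gegenbauerCoeff k (m + 2 * j) j| ≤ 2 ^ (m + 2 * j) * (k + (m + j : ℕ)) ^ (m + j) := by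
  have hG := Real.Gamma_pos_of_pos hk
  have h := Gamma_add_nat_le hk (m + j)
  have e : k + ((m + 2 * j : ℕ) : ℝ) - j = k + (m + j : ℕ) := by push_cast; ring
  have hG2 : 0 < Real.Gamma (k + (m + j : ℕ)) := Real.Gamma_pos_of_pos (by positivity)
  have hden : (1 : ℝ) ≤ 2 ^ (2 * j) * (j ! : ℝ) * ((m + 2 * j - 2 * j)! : ℝ) := by
    have h1 : (1 : ℝ) ≤ 2 ^ (2 * j) := one_le_pow₀ (by norm_num)
    have h2 : (1 : ℝ) ≤ (j ! : ℝ) := by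
      exact_mod_cast Nat.one_le_iff_ne_zero.mpr (Nat.factorial_ne_zero j)
    have h3 : (1 : ℝ) ≤ ((m + 2 * j - 2 * j)! : ℝ) := by
      exact_mod_cast Nat.one_le_iff_ne_zero.mpr (Nat.factorial_ne_zero _)
    exact one_le_mul_of_one_le_of_one_le (one_le_mul_of_one_le_of_one_le h1 h2) h3
  unfold gegenbauerCoeff
  rw [e, abs_mul, abs_div, abs_div, abs_mul, abs_pow, abs_pow, abs_neg, abs_one, one_pow, one_mul,
    abs_of_pos hG, abs_of_pos hG2, abs_of_pos (lt_of_lt_of_le one_pos hden),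
    abs_of_pos (two_pos : (0 : ℝ) < 2)]
  calc 2 ^ (m + 2 * j) / Real.Gamma k * (Real.Gamma (k + (m + j : ℕ)) / _)
      ≤ 2 ^ (m + 2 * j) / Real.Gamma k * Real.Gamma (k + (m + j : ℕ)) := by
        gcongr
        exact div_le_self hG2.le hden
    _ ≤ 2 ^ (m + 2 * j) / Real.Gamma k * ((k + (m + j : ℕ)) ^ (m + j) * Real.Gamma k) := by gcongr
    _ = _ := by field_simp

end gegenbauer

/-! ### The normalized zonal polynomials -/

section zonal

open Polynomial

/-- The polynomial `q` with `p_ℓ^{(k)}(x) = q(x_k)`. -/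
def zonalPoly (n ℓ : ℕ) : ℝ[X] :=
  C (zonalConst n ℓ) * gegenbauerPoly (((n : ℝ) - 2) / 2) ℓ

lemma zonalHarmonic_eq (n ℓ : ℕ) (k : Fin n) (x : UnitSphere n) :
    zonalHarmonic n ℓ k x = (zonalPoly n ℓ).eval ((x : EuclideanSpace ℝ (Fin n)) k) := by
  rw [zonalPoly, eval_C_mul, eval_gegenbauerPoly, zonalHarmonic]

lemma natDegree_zonalPoly_le (n ℓ : ℕ) : (zonalPoly n ℓ).natDegree ≤ ℓ :=
  (natDegree_C_mul_le _ _).trans (natDegree_gegenbauerPoly_le _ _)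

lemma coeff_zonalPoly_of_even (n : ℕ) {ℓ m : ℕ} (hℓ : Odd ℓ) (hm : Even m) :
    (zonalPoly n ℓ).coeff m = 0 := by
  rw [zonalPoly, coeff_C_mul, coeff_gegenbauerPoly_eq_zero, mul_zero]
  rintro j rfl
  rw [Nat.odd_add] at hℓ
  exact Nat.not_odd_iff_even.mpr hm (hℓ.mpr (even_two_mul j))

lemma kappa_pos {n : ℕ} (hn : 3 ≤ n) : 0 < ((n : ℝ) - 2) / 2 := by
  have : (3 : ℝ) ≤ n := by exact_mod_cast hn
  linarith

lemma zonalPoly_ode {n : ℕ} (hn : 3 ≤ n) (ℓ : ℕ) :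
    (1 - X ^ 2) * derivative (derivative (zonalPoly n ℓ)) -
      C ((n : ℝ) - 1) * (X * derivative (zonalPoly n ℓ)) =
      -(C (ℓ * ((n : ℝ) + ℓ - 2)) * zonalPoly n ℓ) := by
  have h := gegenbauerPoly_ode (kappa_pos hn) ℓ
  rw [show 2 * (((n : ℝ) - 2) / 2) + 1 = n - 1 by ring,
    show (ℓ : ℝ) + 2 * (((n : ℝ) - 2) / 2) = n + ℓ - 2 by ring] at h
  rw [zonalPoly, derivative_C_mul, derivative_C_mul]
  linear_combination C (zonalConst n ℓ) * h

lemma zonalConst_sq {N : ℕ} (ℓ : ℕ) : zonalConst (N + 3) ℓ ^ 2 =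
    (N ! : ℝ) * (ℓ ! : ℝ) * ((N : ℝ) + 1 + 2 * ℓ) / (((N + ℓ)! : ℝ) * ((N : ℝ) + 1)) := by
  rw [zonalConst, show N + 3 - 3 = N by omega, show N + 3 + ℓ - 3 = N + ℓ by omega]
  have e1 : ((N + 3 : ℕ) : ℝ) + 2 * ℓ - 2 = N + 1 + 2 * ℓ := by push_cast; ring
  have e2 : ((N + 3 : ℕ) : ℝ) - 2 = N + 1 := by push_cast; ring
  rw [e1, e2, Real.sq_sqrt (by positivity)]

lemma momentFunctional_zonalPoly_sq {n : ℕ} (hn : 3 ≤ n) (ℓ : ℕ) :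
    momentFunctional n (zonalPoly n ℓ ^ 2) = 1 := by
  have h := momentFunctional_gegenbauerPoly_sq ℓ (kappa_pos hn)
  obtain ⟨N, rfl⟩ : ∃ N, n = N + 3 := ⟨n - 3, by omega⟩
  have e0 : (((N + 3 : ℕ) : ℝ) - 2) / 2 = (N + 1) / 2 := by push_cast; ring
  have e1 : 2 * (((N : ℝ) + 1) / 2) = N + 1 := by ring
  have e2 : (N : ℝ) + 1 + ℓ = ((N + ℓ : ℕ) : ℝ) + 1 := by push_cast; ring
  have e3 : (N : ℝ) + 1 + 2 = (N + 3 : ℕ) := by push_cast; ring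
  rw [e0, e1, e2, e3, Real.Gamma_nat_eq_factorial, Real.Gamma_nat_eq_factorial] at h
  rw [zonalPoly, mul_pow, ← C_pow, ← smul_eq_C_mul, map_smul, e0, h, zonalConst_sq, smul_eq_mul]
  have := Nat.cast_ne_zero (R := ℝ).mpr (Nat.factorial_ne_zero ℓ)
  have := Nat.cast_ne_zero (R := ℝ).mpr (Nat.factorial_ne_zero N)
  have := Nat.cast_ne_zero (R := ℝ).mpr (Nat.factorial_ne_zero (N + ℓ))
  have : (ℓ : ℝ) + (N + 1) / 2 ≠ 0 := by positivity
  have : (ℓ : ℝ) * 2 + (N + 1) ≠ 0 := by positivity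
  field_simp
  ring

/-- The diagonal is the choice of the constant `A`; oddness of `ℓ` serves only off the diagonal. -/
lemma integral_zonalHarmonic_mul {ℓ : ℕ} (hℓ : Odd ℓ) {n : ℕ} (hn : 3 ≤ n) (i j : Fin n) :
    ∫ x, zonalHarmonic n ℓ i x * zonalHarmonic n ℓ j x ∂(uniformSphere n) =
      if i = j then 1 else 0 := by
  simp only [zonalHarmonic_eq]
  split_ifs with h
  · subst h
    simp only [← pow_two, ← eval_pow]
    rw [integral_eval (by omega), momentFunctional_zonalPoly_sq hn]
  · exact integral_eval_mul_eval_of_odd h _ _ fun m hm => coeff_zonalPoly_of_even n hℓ hm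

/-- The scaling of the zonal polynomials: the coefficient of `t^m` is of order `n^{m/2}`. -/
lemma exists_abs_coeff_zonalPoly_le (ℓ : ℕ) : ∃ K : ℝ, 0 ≤ K ∧ ∀ n : ℕ, 3 ≤ n → ∀ m,
    |(zonalPoly n ℓ).coeff m| ≤ K * √n ^ m := by
  refine ⟨√((ℓ ! : ℝ) * 3 ^ ℓ * (1 + 2 * ℓ)) * (2 ^ ℓ * (1 + ℓ) ^ ℓ), by positivity, ?_⟩
  intro n hn m
  by_cases h : ∃ j, ℓ = m + 2 * j
  swap
  · push Not at h
    rw [zonalPoly, coeff_C_mul, coeff_gegenbauerPoly_eq_zero _ h, mul_zero, abs_zero]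
    positivity
  have hn3 : (3 : ℝ) ≤ n := by exact_mod_cast hn
  -- `A²` is of order `n^{-ℓ}` since `(N+ℓ)!/N! ≥ (N+1)^ℓ`; the power of `3` comes from `N + 3 ≤ 3
  -- (N + 1)`.
  have hA : |zonalConst n ℓ| * √n ^ ℓ ≤ √((ℓ ! : ℝ) * 3 ^ ℓ * (1 + 2 * ℓ)) := by
    apply Real.le_sqrt_of_sq_le
    rw [mul_pow, sq_abs, ← pow_mul, mul_comm ℓ 2, pow_mul, Real.sq_sqrt (by positivity)]
    obtain ⟨N, rfl⟩ : ∃ N, n = N + 3 := ⟨n - 3, by omega⟩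
    rw [zonalConst_sq, div_mul_eq_mul_div, div_le_iff₀ (by positivity)]
    have h1 : (N ! : ℝ) * (N + 1) ^ ℓ ≤ ((N + ℓ)! : ℝ) := by
      exact_mod_cast Nat.factorial_mul_pow_le_factorial
    have h2 : ((N + 3 : ℕ) : ℝ) ≤ 3 * (N + 1) := by push_cast; linarith [Nat.cast_nonneg (α := ℝ) N]
    have h3 : (N : ℝ) + 1 + 2 * ℓ ≤ (1 + 2 * ℓ) * (N + 1) := by
      have : (0 : ℝ) ≤ ℓ * N := by positivity
      nlinarith
    calc (N ! : ℝ) * ℓ ! * (N + 1 + 2 * ℓ) * ((N + 3 : ℕ) : ℝ) ^ ℓ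
        ≤ (N ! : ℝ) * ℓ ! * ((1 + 2 * ℓ) * (N + 1)) * (3 * (N + 1)) ^ ℓ := by gcongr
      _ = ℓ ! * 3 ^ ℓ * (1 + 2 * ℓ) * ((N ! * (N + 1) ^ ℓ) * (N + 1)) := by rw [mul_pow]; ring
      _ ≤ ℓ ! * 3 ^ ℓ * (1 + 2 * ℓ) * (((N + ℓ)! : ℝ) * (N + 1)) := by gcongr
  -- With `ℓ = m + 2j` the coefficient has order `n^{m+j} = √n^ℓ √n^m`; the first factor is
  -- cancelled by `A`.
  have hc : |(gegenbauerPoly (((n : ℝ) - 2) / 2) ℓ).coeff m| ≤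
      2 ^ ℓ * (1 + ℓ) ^ ℓ * (√n ^ ℓ * √n ^ m) := by
    obtain ⟨j, rfl⟩ := h
    rw [coeff_gegenbauerPoly]
    refine (abs_gegenbauerCoeff_le (kappa_pos hn) m j).trans ?_
    have e : √(n : ℝ) ^ (m + 2 * j) * √(n : ℝ) ^ m = n ^ (m + j) := by
      rw [← pow_add, show m + 2 * j + m = 2 * (m + j) by ring, pow_mul,
        Real.sq_sqrt (by positivity)]
    rw [e, mul_assoc]
    gcongr
    calc (((n : ℝ) - 2) / 2 + ((m + j : ℕ) : ℝ)) ^ (m + j)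
        ≤ ((1 + ((m + 2 * j : ℕ) : ℝ)) * n) ^ (m + j) := by
          have hκ := (kappa_pos hn).le
          gcongr
          push_cast
          have : (0 : ℝ) ≤ m := by positivity
          have : (0 : ℝ) ≤ j := by positivity
          nlinarith
      _ = (1 + ((m + 2 * j : ℕ) : ℝ)) ^ (m + j) * n ^ (m + j) := mul_pow _ _ _
      _ ≤ (1 + ((m + 2 * j : ℕ) : ℝ)) ^ (m + 2 * j) * n ^ (m + j) := by
          gcongr
          · have : (0 : ℝ) ≤ ((m + 2 * j : ℕ) : ℝ) := by positivity
            linarith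
          · omega
  rw [zonalPoly, coeff_C_mul, abs_mul]
  calc |zonalConst n ℓ| * |(gegenbauerPoly (((n : ℝ) - 2) / 2) ℓ).coeff m|
      ≤ |zonalConst n ℓ| * (2 ^ ℓ * (1 + ℓ) ^ ℓ * (√n ^ ℓ * √n ^ m)) := by gcongr
    _ = (|zonalConst n ℓ| * √n ^ ℓ) * (2 ^ ℓ * (1 + ℓ) ^ ℓ * √n ^ m) := by ring
    _ ≤ √((ℓ ! : ℝ) * 3 ^ ℓ * (1 + 2 * ℓ)) * (2 ^ ℓ * (1 + ℓ) ^ ℓ * √n ^ m) := by gcongr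
    _ = _ := by ring

end zonal

/-! ### The zonal harmonics are eigenfunctions of the Laplacian -/

section eigenfunction

open Polynomial Filter Topology

/-- Reduces each term of the Laplacian to a one-variable computation along a line. -/
lemma iteratedFDeriv_two_diag {E : Type*} [NormedAddCommGroup E] [NormedSpace ℝ E] {f : E → ℝ}
    {x v : E} (hf : ContDiffAt ℝ 2 f x) {f' : ℝ → ℝ} {D : ℝ}
    (h1 : ∀ᶠ t in 𝓝 (0 : ℝ), HasDerivAt (fun t : ℝ => f (x + t • v)) (f' t) t)
    (h2 : HasDerivAt f' D 0) :
    iteratedFDeriv ℝ 2 f x ![v, v] = D := by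
  have hline : ∀ t : ℝ, HasDerivAt (fun t : ℝ => x + t • v) v t := fun t => by
    simpa using ((hasDerivAt_id t).smul_const v).const_add x
  have htend : Tendsto (fun t : ℝ => x + t • v) (𝓝 0) (𝓝 x) := by
    simpa using (hline 0).continuousAt.tendsto
  have hd : ∀ᶠ y in 𝓝 x, DifferentiableAt ℝ f y :=
    (hf.eventually (by simp)).mono fun y hy => hy.differentiableAt (by simp)
  have heq : f' =ᶠ[𝓝 0] fun t => fderiv ℝ f (x + t • v) v := by
    filter_upwards [h1, htend.eventually hd] with t ht hdt
    exact ht.unique (hdt.hasFDerivAt.comp_hasDerivAt t (hline t))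
  have hdd : DifferentiableAt ℝ (fderiv ℝ f) (x + (0 : ℝ) • v) := by
    simpa using (hf.fderiv_right (m := 1) (by norm_num)).differentiableAt one_ne_zero
  have h3 : HasDerivAt (fun t : ℝ => fderiv ℝ f (x + t • v) v)
      (fderiv ℝ (fderiv ℝ f) (x + (0 : ℝ) • v) v v) 0 := by
    have h := hdd.hasFDerivAt.comp_hasDerivAt (0 : ℝ) (hline 0)
    exact (ContinuousLinearMap.apply ℝ ℝ v).hasFDerivAt.comp_hasDerivAt (0 : ℝ) h
  have h4 := h3.unique (h2.congr_of_eventuallyEq heq.symm)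
  rw [zero_smul, add_zero] at h4
  rw [iteratedFDeriv_two_apply]
  exact h4

/-- The second derivative at `0` of `t ↦ q(u / |x + t e|)`, where `u = a + tδ` and
`|x + t e|² = 1 + 2bt + t²`. -/
lemma hasDerivAt_eval_normalized (q : ℝ[X]) (a b δ : ℝ) :
    ∃ f' : ℝ → ℝ, (∀ᶠ t in 𝓝 (0 : ℝ),
        HasDerivAt (fun t : ℝ => q.eval ((√(1 + 2 * t * b + t ^ 2))⁻¹ * (a + t * δ))) (f' t) t) ∧
      HasDerivAt f' ((derivative (derivative q)).eval a * (δ - a * b) ^ 2 +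
        (derivative q).eval a * (-2 * δ * b + a * (3 * b ^ 2 - 1))) 0 := by
  set R : ℝ → ℝ := fun t => (√(1 + 2 * t * b + t ^ 2))⁻¹ with hR
  have hR0 : R 0 = 1 := by simp [hR]
  have hRd : ∀ t, 0 < 1 + 2 * t * b + t ^ 2 → HasDerivAt R (-(b + t) * R t ^ 3) t := by
    intro t ht
    have h1 : HasDerivAt (fun t : ℝ => 1 + 2 * t * b + t ^ 2) (2 * b + 2 * t) t := by
      have := ((((hasDerivAt_id t).const_mul 2).mul_const b).const_add 1).add
        (hasDerivAt_pow 2 t)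
      exact this.congr_deriv (by simp)
    have hs : √(1 + 2 * t * b + t ^ 2) ≠ 0 := (Real.sqrt_pos.mpr ht).ne'
    refine ((h1.sqrt ht.ne').inv hs).congr_deriv ?_
    simp only [hR]
    field_simp
  set w : ℝ → ℝ := fun t => R t * (a + t * δ) with hw
  have hu : ∀ t : ℝ, HasDerivAt (fun t : ℝ => a + t * δ) δ t := fun t => by
    simpa using ((hasDerivAt_id t).mul_const δ).const_add a
  have hwd : ∀ t, 0 < 1 + 2 * t * b + t ^ 2 →
      HasDerivAt w (-(b + t) * R t ^ 3 * (a + t * δ) + R t * δ) t := fun t ht =>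
    (hRd t ht).mul (hu t)
  have hpos : ∀ᶠ t in 𝓝 (0 : ℝ), 0 < 1 + 2 * t * b + t ^ 2 := by
    have hc : ContinuousAt (fun t : ℝ => 1 + 2 * t * b + t ^ 2) 0 := by fun_prop
    exact hc.eventually (lt_mem_nhds (by simp))
  have h0 : (0 : ℝ) < 1 + 2 * 0 * b + 0 ^ 2 := by simp
  refine ⟨fun t => (derivative q).eval (w t) * (-(b + t) * R t ^ 3 * (a + t * δ) + R t * δ),
    ?_, ?_⟩
  · filter_upwards [hpos] with t ht
    exact (q.hasDerivAt (w t)).comp t (hwd t ht)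
  · have hb : HasDerivAt (fun t : ℝ => -(b + t)) (-1) 0 := ((hasDerivAt_id (0 : ℝ)).const_add b).neg
    have hq := ((derivative q).hasDerivAt (w 0)).comp 0 (hwd 0 h0)
    have hw2 := ((hb.mul ((hRd 0 h0).pow 3)).mul (hu 0)).add ((hRd 0 h0).mul_const δ)
    refine (hq.mul hw2).congr_deriv ?_
    simp [hw, hR0]
    ring

lemma radialExtension_zonalHarmonic (n ℓ : ℕ) (k : Fin n) {y : EuclideanSpace ℝ (Fin n)}
    (hy : y ≠ 0) :
    radialExtension (zonalHarmonic n ℓ k) y = (zonalPoly n ℓ).eval (‖y‖⁻¹ * y k) := by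
  rw [radialExtension, dif_neg hy, zonalHarmonic_eq]
  simp

lemma contDiffAt_radial (n ℓ : ℕ) (k : Fin n) {y : EuclideanSpace ℝ (Fin n)} (hy : y ≠ 0) :
    ContDiffAt ℝ ∞ (fun y => (zonalPoly n ℓ).eval (‖y‖⁻¹ * y k)) y := by
  have h1 : ContDiffAt ℝ ∞ (fun y : EuclideanSpace ℝ (Fin n) => ‖y‖) y := contDiffAt_norm ℝ hy
  have h2 : ContDiffAt ℝ ∞ (fun y : EuclideanSpace ℝ (Fin n) => ‖y‖⁻¹ * y k) y :=
    (h1.inv (norm_ne_zero_iff.mpr hy)).mul (by fun_prop)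
  have h3 := Polynomial.contDiff_aeval (𝕜 := ℝ) (zonalPoly n ℓ) ∞
  simp only [coe_aeval_eq_eval] at h3
  exact h3.contDiffAt.comp y h2

lemma radialExtension_eventuallyEq (n ℓ : ℕ) (k : Fin n) {y : EuclideanSpace ℝ (Fin n)}
    (hy : y ≠ 0) :
    radialExtension (zonalHarmonic n ℓ k) =ᶠ[𝓝 y]
      fun y => (zonalPoly n ℓ).eval (‖y‖⁻¹ * y k) := by
  filter_upwards [isOpen_ne.mem_nhds hy] with z hz
  exact radialExtension_zonalHarmonic n ℓ k hz

/-- Summing the second derivatives over the standard basis gives `(1 - y_k²) q''(y_k) - (n-1) y_k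
q'(y_k)`, the left side of the Gegenbauer equation. -/
lemma sphereLaplacian_zonalHarmonic {n : ℕ} (hn : 3 ≤ n) (ℓ : ℕ) (k : Fin n) (x : UnitSphere n) :
    sphereLaplacian (zonalHarmonic n ℓ k) x =
      -((ℓ : ℝ) * ((n : ℝ) + ℓ - 2)) * zonalHarmonic n ℓ k x := by
  have hx : (x : EuclideanSpace ℝ (Fin n)) ≠ 0 := by
    have : ‖(x : EuclideanSpace ℝ (Fin n))‖ = 1 := by simp
    intro h
    rw [h] at this
    simp at this
  set q := zonalPoly n ℓ with hq
  set y : EuclideanSpace ℝ (Fin n) := (x : EuclideanSpace ℝ (Fin n)) with hy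
  rw [sphereLaplacian,
    (InnerProductSpace.laplacian_congr_nhds (radialExtension_eventuallyEq n ℓ k hx)).eq_of_nhds,
    InnerProductSpace.laplacian_eq_iteratedFDeriv_orthonormalBasis _
      (EuclideanSpace.basisFun (Fin n) ℝ)]
  have hterm : ∀ i : Fin n, iteratedFDeriv ℝ 2
      (fun y : EuclideanSpace ℝ (Fin n) => q.eval (‖y‖⁻¹ * y k)) y
      ![EuclideanSpace.basisFun (Fin n) ℝ i, EuclideanSpace.basisFun (Fin n) ℝ i] =
      (derivative (derivative q)).eval (y k) * ((if i = k then 1 else 0) - y k * y i) ^ 2 +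
        (derivative q).eval (y k) *
          (-2 * (if i = k then 1 else 0) * y i + y k * (3 * y i ^ 2 - 1)) := by
    intro i
    obtain ⟨f', h1, h2⟩ := hasDerivAt_eval_normalized q (y k) (y i) (if i = k then 1 else 0)
    refine iteratedFDeriv_two_diag ((contDiffAt_radial n ℓ k hx).of_le (by norm_cast))
      ?_ h2
    have e : ∀ t : ℝ, ‖y + t • EuclideanSpace.basisFun (Fin n) ℝ i‖ =
        √(1 + 2 * t * y i + t ^ 2) := by
      intro t
      have hy1 : ‖y‖ = 1 := by simp [hy]
      rw [← Real.sqrt_sq (norm_nonneg _), norm_add_sq_real, hy1]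
      congr 1
      simp [inner_smul_right, norm_smul, EuclideanSpace.inner_single_right]
      ring
    have e2 : ∀ t : ℝ, (y + t • EuclideanSpace.basisFun (Fin n) ℝ i) k =
        y k + t * (if i = k then 1 else 0) := by
      intro t
      simp [eq_comm]
    simpa only [e, e2] using h1
  simp only [← hq, hterm]
  have hs : ∑ i, y i ^ 2 = 1 := sum_sq_sphere x
  have hA : ∑ i, ((if i = k then 1 else 0) - y k * y i) ^ 2 = 1 - y k ^ 2 := by
    have : ∀ i, ((if i = k then 1 else 0) - y k * y i) ^ 2 =
        (if i = k then 1 - 2 * y k * y i else 0) + y k ^ 2 * y i ^ 2 := by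
      intro i; split_ifs <;> ring
    simp only [this, Finset.sum_add_distrib, ← Finset.mul_sum, hs]
    simp
    ring
  have hB : ∑ i, (-2 * (if i = k then 1 else 0) * y i + y k * (3 * y i ^ 2 - 1)) =
      -(((n : ℝ) - 1) * y k) := by
    have : ∀ i, (-2 * (if i = k then 1 else 0) * y i + y k * (3 * y i ^ 2 - 1)) =
        (if i = k then -2 * y i else 0) + 3 * y k * y i ^ 2 - y k := by
      intro i; split_ifs <;> ring
    simp only [this, Finset.sum_add_distrib, Finset.sum_sub_distrib, ← Finset.mul_sum, hs]
    simp
    ring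
  rw [Finset.sum_add_distrib, ← Finset.mul_sum, ← Finset.mul_sum, hA, hB, zonalHarmonic_eq]
  have hode := congrArg (Polynomial.eval (y k)) (zonalPoly_ode hn ℓ)
  simp only [eval_sub, eval_mul, eval_one, eval_pow, eval_X, eval_C, eval_neg] at hode
  simp only [← hq, ← hy] at hode ⊢
  linear_combination hode

lemma isSphereEigenfunction_zonalHarmonic {ℓ : ℕ} (hℓ : Odd ℓ) {n : ℕ} (hn : 3 ≤ n) (k : Fin n) :
    IsSphereEigenfunction ℓ (zonalHarmonic n ℓ k) := by
  refine ⟨?_, ?_, sphereLaplacian_zonalHarmonic hn ℓ k⟩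
  · intro h
    have h1 := integral_zonalHarmonic_mul hℓ hn k k
    simp [h] at h1
  · intro y hy
    exact ((contDiffAt_radial n ℓ k hy).congr_of_eventuallyEq
      (radialExtension_eventuallyEq n ℓ k hy)).contDiffWithinAt

end eigenfunction

/-! ### The Stein equation -/

section stein

open Filter Topology

lemma gaussianPDFReal_std (t : ℝ) :
    gaussianPDFReal 0 1 t = (√(2 * Real.pi))⁻¹ * Real.exp (-(1 / 2) * t ^ 2) := by
  simp [gaussianPDFReal]
  left
  ring

lemma hasDerivAt_gaussianPDFReal_std (t : ℝ) :
    HasDerivAt (gaussianPDFReal 0 1) (-(t * gaussianPDFReal 0 1 t)) t := by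
  have h : gaussianPDFReal 0 1 =
      fun t => (√(2 * Real.pi))⁻¹ * Real.exp (-(1 / 2) * t ^ 2) := by
    ext t; exact gaussianPDFReal_std t
  rw [gaussianPDFReal_std, h]
  refine ((((hasDerivAt_pow 2 t).const_mul (-(1 / 2) : ℝ)).exp).const_mul _).congr_deriv ?_
  norm_num
  ring

lemma integrable_id_mul_gaussianPDFReal_std :
    Integrable (fun t => t * gaussianPDFReal 0 1 t) := by
  have := (integrable_mul_exp_neg_mul_sq (b := 1 / 2) (by norm_num)).const_mul
    (√(2 * Real.pi))⁻¹
  refine this.congr (Eventually.of_forall fun t => ?_)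
  simp only [gaussianPDFReal_std]
  ring

lemma tendsto_gaussianPDFReal_std_cocompact :
    Tendsto (gaussianPDFReal 0 1) (cocompact ℝ) (𝓝 0) := by
  have h : gaussianPDFReal 0 1 =
      fun t => (√(2 * Real.pi))⁻¹ * Real.exp (-(1 / 2) * t ^ 2) := by
    ext t; exact gaussianPDFReal_std t
  rw [h]
  have h1 : Tendsto (fun t : ℝ => t ^ 2) (cocompact ℝ) atTop := by
    have := (tendsto_pow_atTop (α := ℝ) two_ne_zero).comp (tendsto_norm_cocompact_atTop (E := ℝ))
    refine this.congr fun t => ?_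
    simp
  have h2 : Tendsto (fun t : ℝ => -(1 / 2) * t ^ 2) (cocompact ℝ) atBot :=
    h1.const_mul_atTop_of_neg (by norm_num)
  simpa using (Real.tendsto_exp_atBot.comp h2).const_mul (√(2 * Real.pi))⁻¹

/-- With its mirror image below, this supplies the Gaussian tail estimate for the Stein solution. -/
lemma integral_Ioi_id_mul_gaussianPDFReal (w : ℝ) :
    ∫ t in Set.Ioi w, t * gaussianPDFReal 0 1 t = gaussianPDFReal 0 1 w := by
  have h := integral_Ioi_of_hasDerivAt_of_tendsto' (a := w) (m := 0)
    (fun x _ => (hasDerivAt_gaussianPDFReal_std x).neg)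
    (by simpa using integrable_id_mul_gaussianPDFReal_std.integrableOn)
    (by simpa [Pi.neg_def] using
      (tendsto_gaussianPDFReal_std_cocompact.mono_left atTop_le_cocompact).neg)
  simpa using h

lemma integral_Iic_id_mul_gaussianPDFReal (w : ℝ) :
    ∫ t in Set.Iic w, -t * gaussianPDFReal 0 1 t = gaussianPDFReal 0 1 w := by
  have h := integral_Iic_of_hasDerivAt_of_tendsto' (a := w) (m := 0)
    (fun x _ => hasDerivAt_gaussianPDFReal_std x)
    integrable_id_mul_gaussianPDFReal_std.neg.integrableOn
    (tendsto_gaussianPDFReal_std_cocompact.mono_left atBot_le_cocompact)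
  simpa using h

/-- The solution of the Stein equation for a continuous test function. -/
lemma exists_stein_solution {h : ℝ → ℝ} (hc : Continuous h) (h0 : ∀ x, 0 ≤ h x)
    (h1 : ∀ x, h x ≤ 1) :
    ∃ g : ℝ → ℝ, ContDiff ℝ 1 g ∧ (∀ w, |deriv g w| ≤ 2) ∧
      ∀ w, deriv g w - w * g w = h w - ∫ x, h x ∂(gaussianReal 0 1) := by
  set c := ∫ x, h x ∂(gaussianReal 0 1) with hcdef
  set ρ : ℝ → ℝ := gaussianPDFReal 0 1 with hρ
  have hhint : Integrable h (gaussianReal 0 1) :=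
    (integrable_const (1 : ℝ)).mono' hc.aestronglyMeasurable
      (Eventually.of_forall fun x => by rw [Real.norm_of_nonneg (h0 x)]; exact h1 x)
  have hc0 : 0 ≤ c := integral_nonneg h0
  have hc1 : c ≤ 1 := by
    have := integral_mono hhint (integrable_const (1 : ℝ)) h1
    simpa using this
  have hρpos : ∀ t, 0 < ρ t := fun t => gaussianPDFReal_pos 0 1 t one_ne_zero
  have hρd : ∀ t, HasDerivAt ρ (-(t * ρ t)) t := hasDerivAt_gaussianPDFReal_std
  have hρc : Continuous ρ := continuous_iff_continuousAt.mpr fun t => (hρd t).continuousAt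
  have hρint : Integrable ρ := integrable_gaussianPDFReal 0 1
  set ψ : ℝ → ℝ := fun t => (h t - c) * ρ t with hψ
  have hψc : Continuous ψ := (hc.sub continuous_const).mul hρc
  have habs : ∀ t, |h t - c| ≤ 1 := fun t => abs_le.mpr ⟨by linarith [h0 t], by linarith [h1 t]⟩
  have hψle : ∀ t, |ψ t| ≤ ρ t := fun t => by
    rw [hψ, abs_mul, abs_of_pos (hρpos t)]
    exact mul_le_of_le_one_left (hρpos t).le (habs t)
  have hψint : Integrable ψ := hρint.mono' hψc.aestronglyMeasurable (Eventually.of_forall hψle)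
  -- Zero total mass lets `Φ w` be written through either tail, so the tail pointing away from the
  -- origin can be used.
  have hψ0 : ∫ t, ψ t = 0 := by
    have e1 : c = ∫ t, ρ t * h t := by
      rw [hcdef, integral_gaussianReal_eq_integral_smul one_ne_zero]; rfl
    have hi : Integrable (fun t => ρ t * h t) :=
      hρint.mono' (hρc.mul hc).aestronglyMeasurable (Eventually.of_forall fun t => by
        rw [Real.norm_of_nonneg (mul_nonneg (hρpos t).le (h0 t))]
        exact mul_le_of_le_one_right (hρpos t).le (h1 t))
    have e2 : ∀ t, ψ t = ρ t * h t - c * ρ t := fun t => by simp only [hψ]; ring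
    simp only [e2]
    rw [integral_sub hi (hρint.const_mul c), integral_const_mul, ← e1,
      integral_gaussianPDFReal_eq_one 0 one_ne_zero]
    ring
  set Φ : ℝ → ℝ := fun w => ∫ t in Set.Iic w, ψ t with hΦ
  have hΦd : ∀ w, HasDerivAt Φ (ψ w) w := by
    intro w
    have e : Φ = fun w => (∫ t in Set.Iic 0, ψ t) + ∫ t in (0 : ℝ)..w, ψ t := by
      ext w
      rw [← intervalIntegral.integral_Iic_sub_Iic hψint.integrableOn hψint.integrableOn]
      ring
    rw [e]
    exact (intervalIntegral.integral_hasDerivAt_right (hψc.intervalIntegrable _ _)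
      (hψc.stronglyMeasurableAtFilter _ _) hψc.continuousAt).const_add _
  -- Beyond `w` one has `|w| ≤ |t|`, so `|w|` times the Gaussian tail is at most the integral of
  -- `|t| ρ` over it, which is `ρ w`.
  have hΦle : ∀ w, |w * Φ w| ≤ ρ w := by
    intro w
    rcases le_or_gt 0 w with hw | hw
    · have e : Φ w = -∫ t in Set.Ioi w, ψ t := by
        have := intervalIntegral.integral_Iic_add_Ioi (b := w) hψint.integrableOn
          hψint.integrableOn
        rw [hψ0] at this
        linarith
      rw [e, abs_mul, abs_neg, abs_of_nonneg hw]
      calc w * |∫ t in Set.Ioi w, ψ t| ≤ w * ∫ t in Set.Ioi w, ρ t := by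
            gcongr
            exact norm_integral_le_of_norm_le (f := ψ) hρint.integrableOn
              (Eventually.of_forall hψle)
        _ = ∫ t in Set.Ioi w, w * ρ t := (integral_const_mul _ _).symm
        _ ≤ ∫ t in Set.Ioi w, t * ρ t := by
            refine setIntegral_mono_on (hρint.const_mul w).integrableOn
              integrable_id_mul_gaussianPDFReal_std.integrableOn measurableSet_Ioi ?_
            intro t ht
            exact mul_le_mul_of_nonneg_right (le_of_lt ht) (hρpos t).le
        _ = ρ w := integral_Ioi_id_mul_gaussianPDFReal w
    · rw [abs_mul, abs_of_neg hw]
      calc -w * |∫ t in Set.Iic w, ψ t| ≤ -w * ∫ t in Set.Iic w, ρ t := by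
            have : 0 ≤ -w := by linarith
            gcongr
            exact norm_integral_le_of_norm_le (f := ψ) hρint.integrableOn
              (Eventually.of_forall hψle)
        _ = ∫ t in Set.Iic w, -w * ρ t := (integral_const_mul _ _).symm
        _ ≤ ∫ t in Set.Iic w, -t * ρ t := by
            refine setIntegral_mono_on (hρint.const_mul (-w)).integrableOn
              ?_ measurableSet_Iic ?_
            · have := integrable_id_mul_gaussianPDFReal_std.neg.integrableOn (s := Set.Iic w)
              simpa [Pi.neg_def] using this
            · intro t ht
              exact mul_le_mul_of_nonneg_right (neg_le_neg ht) (hρpos t).le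
        _ = ρ w := integral_Iic_id_mul_gaussianPDFReal w
  have hgd : ∀ w, HasDerivAt (fun w => Φ w / ρ w) (w * (Φ w / ρ w) + (h w - c)) w := by
    intro w
    refine ((hΦd w).div (hρd w) (hρpos w).ne').congr_deriv ?_
    have := (hρpos w).ne'
    simp only [hψ]
    field_simp
    ring
  have hgderiv : deriv (fun w => Φ w / ρ w) = fun w => w * (Φ w / ρ w) + (h w - c) :=
    funext fun w => (hgd w).deriv
  refine ⟨fun w => Φ w / ρ w, ?_, ?_, ?_⟩
  · rw [contDiff_one_iff_deriv]
    refine ⟨fun w => (hgd w).differentiableAt, ?_⟩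
    rw [hgderiv]
    have : Continuous (fun w => Φ w / ρ w) :=
      continuous_iff_continuousAt.mpr fun w => (hgd w).continuousAt
    fun_prop
  · intro w
    rw [hgderiv]
    -- The constant `2` is this bound plus `|h - c| ≤ 1`.
    have e : |w * (Φ w / ρ w)| ≤ 1 := by
      rw [← mul_div_assoc, abs_div, abs_of_pos (hρpos w)]
      exact div_le_one_of_le₀ (hΦle w) (hρpos w).le
    exact (abs_add_le _ _).trans (by linarith [habs w])
  · intro w
    rw [hgderiv]
    ring

end stein

/-! ### The total variation distance -/

section tv

lemma bddAbove_tvDist (μ ν : Measure ℝ) [IsProbabilityMeasure μ] [IsProbabilityMeasure ν] :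
    BddAbove (Set.range fun A : {A : Set ℝ // MeasurableSet A} => |μ.real A.1 - ν.real A.1|) := by
  refine ⟨1, ?_⟩
  rintro _ ⟨A, rfl⟩
  have h1 : μ.real A.1 ≤ 1 := measureReal_le_one
  have h2 : ν.real A.1 ≤ 1 := measureReal_le_one
  have h3 : 0 ≤ μ.real A.1 := measureReal_nonneg
  have h4 : 0 ≤ ν.real A.1 := measureReal_nonneg
  exact abs_le.mpr ⟨by linarith, by linarith⟩

lemma tvDist_nonneg (μ ν : Measure ℝ) : 0 ≤ tvDist μ ν :=
  Real.iSup_nonneg fun _ => abs_nonneg _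

/-- Continuous test functions with values in `[0, 1]` suffice to bound the total variation
distance. -/
lemma tvDist_le_of_continuous {μ ν : Measure ℝ} [IsProbabilityMeasure μ] [IsProbabilityMeasure ν]
    {ε : ℝ} (H : ∀ h : ℝ → ℝ, Continuous h → (∀ x, 0 ≤ h x) → (∀ x, h x ≤ 1) →
      |∫ x, h x ∂μ - ∫ x, h x ∂ν| ≤ ε) :
    tvDist μ ν ≤ ε := by
  have : Nonempty {A : Set ℝ // MeasurableSet A} := ⟨⟨∅, MeasurableSet.empty⟩⟩
  refine ciSup_le fun ⟨A, hA⟩ => ?_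
  refine le_of_forall_pos_le_add fun δ hδ => ?_
  -- Approximation in `L¹` of the sum `μ + ν` serves both measures with one function.
  have hI : Integrable (A.indicator (fun _ => (1 : ℝ))) (μ + ν) :=
    (integrable_const 1).indicator hA
  obtain ⟨g, hg, hgi⟩ := hI.exists_boundedContinuous_integral_sub_le hδ
  -- Clamping to `[0, 1]` is a contraction that fixes indicators, so it does not increase the error.
  set h : ℝ → ℝ := fun x => max 0 (min (g x) 1) with hh
  have hcont : Continuous h := by fun_prop
  have h0 : ∀ x, 0 ≤ h x := fun x => le_max_left _ _
  have h1 : ∀ x, h x ≤ 1 := fun x => max_le zero_le_one (min_le_right _ _)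
  have hle : ∀ x, |A.indicator (fun _ => (1 : ℝ)) x - h x| ≤
      ‖A.indicator (fun _ => (1 : ℝ)) x - g x‖ := by
    intro x
    have hclamp : A.indicator (fun _ => (1 : ℝ)) x =
        max 0 (min (A.indicator (fun _ => (1 : ℝ)) x) 1) := by
      by_cases hx : x ∈ A <;> simp [hx]
    rw [Real.norm_eq_abs]
    conv_lhs => rw [hclamp]
    refine (abs_max_sub_max_le_max _ _ _ _).trans (max_le (by simp) ?_)
    exact (abs_min_sub_min_le_max _ _ _ _).trans (max_le le_rfl (by simp))
  have hint : ∀ κ : Measure ℝ, IsProbabilityMeasure κ → Integrable h κ := fun κ _ =>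
    (integrable_const (1 : ℝ)).mono' hcont.aestronglyMeasurable
      (Filter.Eventually.of_forall fun x => by rw [Real.norm_of_nonneg (h0 x)]; exact h1 x)
  have hind : ∀ κ : Measure ℝ, IsProbabilityMeasure κ →
      |κ.real A - ∫ x, h x ∂κ| ≤ ∫ x, |A.indicator (fun _ => (1 : ℝ)) x - h x| ∂κ := by
    intro κ _
    have e : κ.real A = ∫ x, A.indicator (fun _ => (1 : ℝ)) x ∂κ := by
      rw [integral_indicator_const _ hA]; simp
    rw [e, ← integral_sub ((integrable_const 1).indicator hA) (hint κ inferInstance)]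
    exact abs_integral_le_integral_abs
  have hiabs : ∀ κ : Measure ℝ, IsProbabilityMeasure κ →
      Integrable (fun x => |A.indicator (fun _ => (1 : ℝ)) x - h x|) κ := fun κ _ =>
    (((integrable_const 1).indicator hA).sub (hint κ inferInstance)).abs
  have hsum : ∫ x, |A.indicator (fun _ => (1 : ℝ)) x - h x| ∂μ +
      ∫ x, |A.indicator (fun _ => (1 : ℝ)) x - h x| ∂ν ≤ δ := by
    rw [← integral_add_measure (hiabs μ inferInstance) (hiabs ν inferInstance)]
    refine le_trans (integral_mono ((hiabs μ inferInstance).add_measure (hiabs ν inferInstance))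
      (hI.sub hgi).norm hle) hg
  have hm := hind μ inferInstance
  have hn := hind ν inferInstance
  have hH := H h hcont h0 h1
  rw [abs_le] at *
  constructor <;> linarith

/-- The supremum in the total variation distance may be restricted to a countable family of
sets. -/
lemma exists_countable_tvDist_eq : ∃ 𝒜 : Set (Set ℝ), 𝒜.Countable ∧ (∀ A ∈ 𝒜, MeasurableSet A) ∧
    ∀ μ ν : Measure ℝ, IsProbabilityMeasure μ → IsProbabilityMeasure ν →
      tvDist μ ν = ⨆ A : 𝒜, |μ.real A.1 - ν.real A.1| := by
  -- An algebra with countably many generators is countable, and it is dense in measure for every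
  -- finite measure.
  set 𝒜 := generateSetAlgebra (MeasurableSpace.countableGeneratingSet ℝ) with h𝒜
  have hgen : (inferInstance : MeasurableSpace ℝ) = MeasurableSpace.generateFrom 𝒜 := by
    rw [h𝒜, generateFrom_generateSetAlgebra_eq,
      MeasurableSpace.generateFrom_countableGeneratingSet]
  have hdense : ∀ κ : Measure ℝ, IsFiniteMeasure κ → κ.MeasureDense 𝒜 := fun κ _ =>
    Measure.MeasureDense.of_generateFrom_isSetAlgebra_finite κ isSetAlgebra_generateSetAlgebra hgen
  have hmeas : ∀ A ∈ 𝒜, MeasurableSet A := (hdense 0 inferInstance).measurable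
  refine ⟨𝒜, countable_generateSetAlgebra MeasurableSpace.countable_countableGeneratingSet,
    hmeas, fun μ ν _ _ => ?_⟩
  have hbdd := bddAbove_tvDist μ ν
  have hbdd' : BddAbove (Set.range fun A : 𝒜 => |μ.real A.1 - ν.real A.1|) := by
    refine hbdd.mono ?_
    rintro _ ⟨A, rfl⟩
    exact ⟨⟨A.1, hmeas _ A.2⟩, rfl⟩
  have : Nonempty {A : Set ℝ // MeasurableSet A} := ⟨⟨∅, MeasurableSet.empty⟩⟩
  have : Nonempty 𝒜 := (hdense 0 inferInstance).nonempty.to_subtype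
  apply le_antisymm
  · refine ciSup_le fun ⟨A, hA⟩ => le_of_forall_pos_le_add fun δ hδ => ?_
    obtain ⟨B, hB, hAB⟩ := (hdense (μ + ν) inferInstance).approx A hA (measure_ne_top _ _) δ hδ
    have hBm := hmeas B hB
    have hlt : μ.real (symmDiff A B) + ν.real (symmDiff A B) ≤ δ := by
      rw [Measure.add_apply, ← ENNReal.ofReal_toReal (measure_ne_top μ _),
        ← ENNReal.ofReal_toReal (measure_ne_top ν _),
        ← ENNReal.ofReal_add ENNReal.toReal_nonneg ENNReal.toReal_nonneg,
        ENNReal.ofReal_lt_ofReal_iff hδ] at hAB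
      exact hAB.le
    have key : ∀ κ : Measure ℝ, IsProbabilityMeasure κ →
        |κ.real A - κ.real B| ≤ κ.real (symmDiff A B) := fun κ _ =>
      abs_measureReal_sub_le_measureReal_symmDiff hA.nullMeasurableSet hBm.nullMeasurableSet
    have hle := le_ciSup hbdd' ⟨B, hB⟩
    have hm := key μ inferInstance
    have hn := key ν inferInstance
    simp only at hle ⊢
    have : |μ.real A - ν.real A| ≤ |μ.real A - μ.real B| + |μ.real B - ν.real B| +
        |ν.real A - ν.real B| := by
      have := abs_sub_le (μ.real A) (μ.real B) (ν.real A)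
      have := abs_sub_le (μ.real B) (ν.real B) (ν.real A)
      rw [abs_sub_comm (ν.real B)] at this
      linarith
    linarith
  · exact ciSup_le fun A => le_ciSup hbdd ⟨A.1, hmeas _ A.2⟩

/-- An uncountable supremum of measurable functions need not be measurable, hence the countable
family. -/
lemma measurable_tvDist {α : Type*} [MeasurableSpace α] {κ : α → Measure ℝ} {ν : Measure ℝ}
    [∀ a, IsProbabilityMeasure (κ a)] [IsProbabilityMeasure ν]
    (h : ∀ A, MeasurableSet A → Measurable fun a => (κ a).real A) :
    Measurable fun a => tvDist (κ a) ν := by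
  obtain ⟨𝒜, hc, hm, heq⟩ := exists_countable_tvDist_eq
  have : Countable 𝒜 := hc.to_subtype
  simp only [fun a => heq (κ a) ν inferInstance inferInstance]
  exact Measurable.iSup fun A => ((h A.1 (hm _ A.2)).sub_const _).abs

end tv

/-! ### Stein's method on the sphere -/

section combination

open Polynomial

variable {n : ℕ}

/-- The squared norm of the spherical gradient of `∑ a_k q(x_k)`. -/
def gradSq (q : ℝ[X]) (a : Fin n → ℝ) (x : EuclideanSpace ℝ (Fin n)) : ℝ :=
  ∑ j, a j ^ 2 * ((derivative q).eval (x j)) ^ 2 -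
    (∑ j, a j * (x j * (derivative q).eval (x j))) ^ 2

lemma continuous_eval_coord (q : ℝ[X]) (j : Fin n) :
    Continuous fun x : EuclideanSpace ℝ (Fin n) => q.eval (x j) :=
  q.continuous.comp (by fun_prop)

lemma contDiff_eval_coord (q : ℝ[X]) (j : Fin n) :
    ContDiff ℝ 1 fun x : EuclideanSpace ℝ (Fin n) => q.eval (x j) := by
  have h := Polynomial.contDiff_aeval (𝕜 := ℝ) q 1
  simp only [coe_aeval_eq_eval] at h
  exact h.comp (by fun_prop)

lemma hasFDerivAt_eval_coord (q : ℝ[X]) (j : Fin n) (x : EuclideanSpace ℝ (Fin n)) :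
    HasFDerivAt (fun x : EuclideanSpace ℝ (Fin n) => q.eval (x j))
      ((derivative q).eval (x j) •
        (EuclideanSpace.proj j : EuclideanSpace ℝ (Fin n) →L[ℝ] ℝ)) x :=
  HasDerivAt.comp_hasFDerivAt (f := fun x : EuclideanSpace ℝ (Fin n) => x j) x
    (q.hasDerivAt (x j)) (hasFDerivAt_coord j x)

lemma continuous_gradSq (q : ℝ[X]) (a : Fin n → ℝ) : Continuous (gradSq q a) := by
  have := fun j : Fin n => continuous_eval_coord (derivative q) j
  unfold gradSq
  fun_prop

/-- Integration by parts against functions of an eigenfunction `f = ∑ a_k q(x_k)`: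
`μ E[f g(f)] = E[|∇f|² g'(f)]`. -/
lemma integral_mul_comp_eq {q : ℝ[X]} {μ : ℝ}
    (hq : (1 - X ^ 2) * derivative (derivative q) - C ((n : ℝ) - 1) * (X * derivative q) =
      -(C μ * q)) (a : Fin n → ℝ) {g : ℝ → ℝ} (hg : ContDiff ℝ 1 g) :
    ∫ x : UnitSphere n, deriv g (∑ k, a k * q.eval ((x : EuclideanSpace ℝ (Fin n)) k)) *
        gradSq q a x ∂(uniformSphere n) =
      μ * ∫ x : UnitSphere n, (∑ k, a k * q.eval ((x : EuclideanSpace ℝ (Fin n)) k)) *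
        g (∑ k, a k * q.eval ((x : EuclideanSpace ℝ (Fin n)) k)) ∂(uniformSphere n) := by
  set f : EuclideanSpace ℝ (Fin n) → ℝ := fun x => ∑ k, a k * q.eval (x k) with hf
  have hfc : ContDiff ℝ 1 f := ContDiff.sum fun k _ => contDiff_const.mul (contDiff_eval_coord q k)
  have hfd : ∀ x, HasFDerivAt f (∑ k, a k • ((derivative q).eval (x k) •
      (EuclideanSpace.proj k : EuclideanSpace ℝ (Fin n) →L[ℝ] ℝ))) x := fun x =>
    HasFDerivAt.fun_sum fun k _ => (hasFDerivAt_eval_coord q k x).const_mul (a k)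
  have hgc := hg.continuous
  have hg' : Continuous (deriv g) := hg.continuous_deriv le_rfl
  have hfcont := hfc.continuous
  have hq1 := fun j : Fin n => continuous_eval_coord (derivative q) j
  have hq2 := fun j : Fin n => continuous_eval_coord (derivative (derivative q)) j
  have hG := continuous_gradSq q a
  set T : EuclideanSpace ℝ (Fin n) → ℝ := fun x => ∑ k, a k * (x k * (derivative q).eval (x k))
    with hT
  -- `D j` is the tangential derivative along `e_j` of `a_j q'(x_j) g(f)`, the `j`-th component of
  -- `g(f)` times the Euclidean gradient of `f`.
  set D : Fin n → EuclideanSpace ℝ (Fin n) → ℝ := fun j x =>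
    a j * ((derivative (derivative q)).eval (x j) * (1 - x j ^ 2)) * g (f x) +
      a j * (derivative q).eval (x j) *
        (deriv g (f x) * (a j * (derivative q).eval (x j) - x j * T x)) with hD
  have hDc : ∀ j, Continuous (D j) := fun j => by fun_prop
  have hj : ∀ j, ∫ x : UnitSphere n, (D j x - ((n : ℝ) - 1) *
      ((x : EuclideanSpace ℝ (Fin n)) j *
        (a j * (derivative q).eval ((x : EuclideanSpace ℝ (Fin n)) j) * g (f x))))
      ∂(uniformSphere n) = 0 := by
    intro j
    have hH : ContDiff ℝ 1 (fun x : EuclideanSpace ℝ (Fin n) =>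
        a j * (derivative q).eval (x j) * g (f x)) :=
      (contDiff_const.mul (contDiff_eval_coord _ j)).mul (hg.comp hfc)
    have h := integral_fderiv_tangential hH j
    have hd : ∀ x : UnitSphere n, fderiv ℝ (fun x : EuclideanSpace ℝ (Fin n) =>
        a j * (derivative q).eval (x j) * g (f x)) x (stdVec j -
          (x : EuclideanSpace ℝ (Fin n)) j • (x : EuclideanSpace ℝ (Fin n))) = D j x := by
      intro x
      have h1 := ((hasFDerivAt_eval_coord (derivative q) j
        (x : EuclideanSpace ℝ (Fin n))).const_mul (a j)).mul
        (((hg.differentiable one_ne_zero (f x)).hasDerivAt).comp_hasFDerivAt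
          (x : EuclideanSpace ℝ (Fin n)) (hfd x))
      have hs : ∑ k, a k * ((derivative q).eval ((x : EuclideanSpace ℝ (Fin n)) k) *
          ((stdVec j : EuclideanSpace ℝ (Fin n)) k - (x : EuclideanSpace ℝ (Fin n)) j *
            (x : EuclideanSpace ℝ (Fin n)) k)) =
          a j * (derivative q).eval ((x : EuclideanSpace ℝ (Fin n)) j) -
            (x : EuclideanSpace ℝ (Fin n)) j * T x := by
        simp only [mul_sub, Finset.sum_sub_distrib, hT, Finset.mul_sum]
        congr 1
        · simp
        · exact Finset.sum_congr rfl fun k _ => by ring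
      erw [h1.fderiv]
      simp only [Function.comp_apply, _root_.add_apply, _root_.smul_apply,
        _root_.sum_apply, EuclideanSpace.coe_proj, PiLp.sub_apply, PiLp.smul_apply,
        smul_eq_mul, hs, hD]
      simp
      ring
    simp only [hd] at h
    rw [integral_sub, integral_const_mul, h, sub_self]
    · exact integrable_uniformSphere_coe (hDc j)
    · exact integrable_uniformSphere_coe (f := fun x => ((n : ℝ) - 1) *
        (x j * (a j * (derivative q).eval (x j) * g (f x)))) (by fun_prop)
  have hode : ∀ t : ℝ, (derivative (derivative q)).eval t * (1 - t ^ 2) =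
      (n - 1) * (t * (derivative q).eval t) - μ * q.eval t := by
    intro t
    have := congrArg (Polynomial.eval t) hq
    simp only [eval_sub, eval_mul, eval_one, eval_pow, eval_X, eval_C, eval_neg] at this
    linear_combination this
  -- The differential equation cancels the `n - 1` terms, leaving the squared gradient and `μ f`.
  have hsum : ∀ x : UnitSphere n, ∑ j, (D j x - ((n : ℝ) - 1) *
      ((x : EuclideanSpace ℝ (Fin n)) j *
        (a j * (derivative q).eval ((x : EuclideanSpace ℝ (Fin n)) j) * g (f x)))) =
      deriv g (f x) * gradSq q a x - μ * (f x * g (f x)) := by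
    intro x
    have e : ∀ j, D j x - ((n : ℝ) - 1) * ((x : EuclideanSpace ℝ (Fin n)) j *
        (a j * (derivative q).eval ((x : EuclideanSpace ℝ (Fin n)) j) * g (f x))) =
        deriv g (f x) * (a j ^ 2 * ((derivative q).eval ((x : EuclideanSpace ℝ (Fin n)) j)) ^ 2) -
        deriv g (f x) * T x * (a j * ((x : EuclideanSpace ℝ (Fin n)) j *
          (derivative q).eval ((x : EuclideanSpace ℝ (Fin n)) j))) -
        μ * g (f x) * (a j * q.eval ((x : EuclideanSpace ℝ (Fin n)) j)) := by
      intro j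
      simp only [hD, hode]
      ring
    simp only [e, Finset.sum_sub_distrib, ← Finset.mul_sum]
    rw [gradSq]
    change _ - deriv g (f x) * T x * T x - μ * g (f x) * f x =
      deriv g (f x) * (_ - T x ^ 2) - _
    ring
  have h := integral_finsetSum (μ := uniformSphere n) Finset.univ
    (f := fun j (x : UnitSphere n) => D j x - ((n : ℝ) - 1) *
      ((x : EuclideanSpace ℝ (Fin n)) j *
        (a j * (derivative q).eval ((x : EuclideanSpace ℝ (Fin n)) j) * g (f x))))
    (fun j _ => integrable_uniformSphere_coe (f := fun x => D j x - ((n : ℝ) - 1) *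
      (x j * (a j * (derivative q).eval (x j) * g (f x)))) (by have := hDc j; fun_prop))
  simp only [hj, Finset.sum_const_zero, hsum] at h
  rw [integral_sub, integral_const_mul] at h
  · linarith
  · exact integrable_uniformSphere_coe (f := fun x => deriv g (f x) * gradSq q a x) (by fun_prop)
  · exact integrable_uniformSphere_coe (f := fun x => μ * (f x * g (f x))) (by fun_prop)

lemma zonalCombination_eq (ℓ : ℕ) (a : Fin n → ℝ) (x : UnitSphere n) :
    zonalCombination n ℓ a x =
      ∑ k, a k * (zonalPoly n ℓ).eval ((x : EuclideanSpace ℝ (Fin n)) k) := by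
  simp only [zonalCombination, zonalHarmonic_eq]

lemma continuous_zonalCombination_uncurry (ℓ : ℕ) :
    Continuous fun p : (Fin n → ℝ) × UnitSphere n => zonalCombination n ℓ p.1 p.2 := by
  simp only [zonalCombination_eq]
  have : ∀ k, Continuous fun p : (Fin n → ℝ) × UnitSphere n =>
      (zonalPoly n ℓ).eval ((p.2 : EuclideanSpace ℝ (Fin n)) k) := fun k =>
    (continuous_eval_coord (zonalPoly n ℓ) k).comp (continuous_subtype_val.comp continuous_snd)
  fun_prop

lemma continuous_zonalCombination (ℓ : ℕ) (a : Fin n → ℝ) :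
    Continuous (zonalCombination n ℓ a) :=
  (continuous_zonalCombination_uncurry ℓ).comp (Continuous.prodMk_right a)

lemma isProbabilityMeasure_map_zonalCombination (hn : 0 < n) (ℓ : ℕ) (a : Fin n → ℝ) :
    IsProbabilityMeasure ((uniformSphere n).map (zonalCombination n ℓ a)) :=
  have := isProbabilityMeasure_uniformSphere hn
  Measure.isProbabilityMeasure_map (continuous_zonalCombination ℓ a).aemeasurable

/-- Stein's bound: the distance to the Gaussian is controlled by the fluctuations of the squared
gradient. -/
lemma zonalTV_le_integral_gradSq (hn : 3 ≤ n) {ℓ : ℕ} {μ : ℝ} (hμ : μ = ℓ * ((n : ℝ) + ℓ - 2))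
    (hμ0 : 0 < μ) (a : Fin n → ℝ) :
    zonalTV n ℓ a ≤ 2 / μ *
      ∫ x : UnitSphere n, |μ - gradSq (zonalPoly n ℓ) a x| ∂(uniformSphere n) := by
  have := isProbabilityMeasure_map_zonalCombination (by omega) ℓ a
  refine tvDist_le_of_continuous fun h hc h0 h1 => ?_
  obtain ⟨g, hg, hg2, hgeq⟩ := exists_stein_solution hc h0 h1
  set q := zonalPoly n ℓ with hq
  set f : UnitSphere n → ℝ := zonalCombination n ℓ a with hf
  have hfc : Continuous f := continuous_zonalCombination ℓ a
  have hG : Continuous fun x : UnitSphere n => gradSq q a x :=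
    (continuous_gradSq q a).comp continuous_subtype_val
  have hg' : Continuous (deriv g) := hg.continuous_deriv le_rfl
  have hgc := hg.continuous
  have hstein := integral_mul_comp_eq (zonalPoly_ode hn ℓ) a hg
  simp only [← hμ, ← hq] at hstein
  simp only [hq, ← zonalCombination_eq] at hstein
  simp only [← hq, ← hf] at hstein
  have hprob := isProbabilityMeasure_uniformSphere (n := n) (by omega)
  -- The Stein equation at `f`, with `E[f g(f)]` replaced by `μ⁻¹ E[g'(f) |∇f|²]`.
  have e : ∫ x, h x ∂((uniformSphere n).map f) - ∫ x, h x ∂(gaussianReal 0 1) =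
      ∫ x, μ⁻¹ * (deriv g (f x) * (μ - gradSq q a x)) ∂(uniformSphere n) := by
    rw [integral_map hfc.aemeasurable hc.aestronglyMeasurable]
    have e1 : ∀ x, μ⁻¹ * (deriv g (f x) * (μ - gradSq q a x)) =
        deriv g (f x) - μ⁻¹ * (deriv g (f x) * gradSq q a x) := by
      intro x; field_simp
    have e2 : ∀ x, deriv g (f x) = h (f x) - ∫ x, h x ∂(gaussianReal 0 1) + f x * g (f x) :=
      fun x => by linarith [hgeq (f x)]
    simp only [e1]
    rw [integral_sub (integrable_uniformSphere (by fun_prop))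
      (integrable_uniformSphere (by fun_prop)), integral_const_mul, hstein]
    simp only [e2]
    rw [integral_add (integrable_uniformSphere (by fun_prop))
      (integrable_uniformSphere (by fun_prop)), integral_sub (integrable_uniformSphere (by fun_prop))
      (integrable_uniformSphere (by fun_prop))]
    simp only [integral_const, probReal_univ, one_smul]
    field_simp
    ring
  rw [e, div_mul_eq_mul_div, mul_div_assoc, ← integral_div, ← integral_const_mul]
  refine abs_integral_le_integral_abs.trans (integral_mono
    (integrable_uniformSphere (by fun_prop)) (integrable_uniformSphere (by fun_prop)) fun x => ?_)
  simp only [abs_mul, abs_inv, abs_of_pos hμ0]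
  rw [div_eq_mul_inv, mul_comm _ μ⁻¹, mul_left_comm 2]
  gcongr
  exact hg2 _

end combination

/-! ### Size of polynomials in one coordinate -/

section size

open Polynomial

/-- A bound `K * s ^ m` on the coefficients expresses size `K` at the scale `t ~ 1/s`; with `s = √n`
this is the scale of one coordinate. Differentiation costs a factor `s`, which multiplication by `X`
gives back. -/
lemma abs_coeff_derivative_le {p : ℝ[X]} {K s : ℝ} (hs : 0 ≤ s) (hK : 0 ≤ K) {d : ℕ}
    (hd : p.natDegree ≤ d) (hp : ∀ m, |p.coeff m| ≤ K * s ^ m) (m : ℕ) :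
    |(derivative p).coeff m| ≤ (d * K * s) * s ^ m := by
  rw [coeff_derivative]
  by_cases hm : m + 1 ≤ d
  · have hm' : (m : ℝ) + 1 ≤ d := by exact_mod_cast hm
    rw [abs_mul, abs_of_pos (by positivity : (0 : ℝ) < (m : ℝ) + 1)]
    calc |p.coeff (m + 1)| * (m + 1) ≤ (K * s ^ (m + 1)) * d := by
          gcongr
          exact hp _
      _ = _ := by ring
  · rw [coeff_eq_zero_of_natDegree_lt (by omega), zero_mul, abs_zero]
    positivity

lemma abs_coeff_X_mul_derivative_le {p : ℝ[X]} {K s : ℝ} (hs : 0 ≤ s) (hK : 0 ≤ K) {d : ℕ}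
    (hd : p.natDegree ≤ d) (hp : ∀ m, |p.coeff m| ≤ K * s ^ m) (m : ℕ) :
    |(X * derivative p).coeff m| ≤ (d * K) * s ^ m := by
  rcases m with _ | m
  · rw [coeff_X_mul_zero, abs_zero]; positivity
  · rw [coeff_X_mul]
    exact (abs_coeff_derivative_le hs hK hd hp m).trans_eq (by ring)

lemma abs_coeff_mul_le {p r : ℝ[X]} {K L s : ℝ} (hs : 0 ≤ s) (hK : 0 ≤ K) (hL : 0 ≤ L) {d : ℕ}
    (hd : (p * r).natDegree ≤ d) (hp : ∀ m, |p.coeff m| ≤ K * s ^ m)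
    (hr : ∀ m, |r.coeff m| ≤ L * s ^ m) (m : ℕ) :
    |(p * r).coeff m| ≤ ((d + 1) * (K * L)) * s ^ m := by
  by_cases hm : m ≤ d
  · rw [coeff_mul]
    calc |∑ x ∈ Finset.HasAntidiagonal.antidiagonal m, p.coeff x.1 * r.coeff x.2|
        ≤ ∑ x ∈ Finset.HasAntidiagonal.antidiagonal m, K * L * s ^ m := by
          refine (Finset.abs_sum_le_sum_abs _ _).trans (Finset.sum_le_sum fun x hx => ?_)
          rw [Finset.HasAntidiagonal.mem_antidiagonal] at hx
          rw [abs_mul, ← hx, pow_add]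
          calc |p.coeff x.1| * |r.coeff x.2| ≤ (K * s ^ x.1) * (L * s ^ x.2) := by
                gcongr
                · exact hp _
                · exact hr _
            _ = _ := by ring
      _ = (m + 1) * (K * L * s ^ m) := by simp
      _ ≤ (d + 1) * (K * L * s ^ m) := by gcongr
      _ = _ := by ring
  · rw [coeff_eq_zero_of_natDegree_lt (by omega), abs_zero]
    positivity

lemma abs_momentFunctional_le {N : ℝ} (hN : 0 < N) {p : ℝ[X]} {K : ℝ} (hK : 0 ≤ K) {d : ℕ}
    (hd : p.natDegree ≤ d) (hp : ∀ m, |p.coeff m| ≤ K * √N ^ m) :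
    |momentFunctional N p| ≤ (d + 1) * d ! * K := by
  rw [momentFunctional_eq_sum N p (Nat.lt_succ_of_le hd)]
  calc |∑ m ∈ Finset.range (d + 1), p.coeff m * sphereMoment N m|
      ≤ ∑ m ∈ Finset.range (d + 1), K * d ! := by
        refine (Finset.abs_sum_le_sum_abs _ _).trans (Finset.sum_le_sum fun m hm => ?_)
        rw [Finset.mem_range] at hm
        rw [abs_mul, abs_of_nonneg (sphereMoment_nonneg hN m)]
        calc |p.coeff m| * sphereMoment N m ≤ K * √N ^ m * sphereMoment N m :=
              mul_le_mul_of_nonneg_right (hp m) (sphereMoment_nonneg hN m)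
          _ = K * (√N ^ m * sphereMoment N m) := by ring
          _ ≤ K * (m ! : ℝ) := by gcongr; exact sphereMoment_le hN m
          _ ≤ K * d ! := by
              gcongr
              exact Nat.le_of_lt_succ hm
    _ = _ := by simp; ring

/-- The coefficients contribute exactly the powers of `√n` that normalize the mixed moments, so the
correlation bound leaves a gain of `1/n`. -/
lemma abs_covariance_eval_le {n : ℕ} {i k : Fin n} (hik : i ≠ k) {p : ℝ[X]} {K : ℝ} (hK : 0 ≤ K)
    {d : ℕ} (hd : p.natDegree ≤ d) (hp : ∀ m, |p.coeff m| ≤ K * √n ^ m) :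
    |∫ x : UnitSphere n, p.eval ((x : EuclideanSpace ℝ (Fin n)) i) *
      p.eval ((x : EuclideanSpace ℝ (Fin n)) k) ∂(uniformSphere n) - momentFunctional n p ^ 2| ≤
      (d + 1) ^ 2 * (d * d * (d ! * d !)) * K ^ 2 / n := by
  have hn2 := two_le_of_ne hik
  have hn : (0 : ℝ) < n := by linarith
  rw [integral_eval_mul_eval i k p p (Nat.lt_succ_of_le hd) (Nat.lt_succ_of_le hd),
    momentFunctional_eq_sum _ p (Nat.lt_succ_of_le hd), pow_two (Finset.sum _ _),
    Finset.sum_mul_sum, ← Finset.sum_sub_distrib]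
  simp only [← Finset.sum_sub_distrib]
  calc |∑ m ∈ Finset.range (d + 1), ∑ l ∈ Finset.range (d + 1),
        (p.coeff m * p.coeff l * pairMoment i k m l -
          p.coeff m * sphereMoment n m * (p.coeff l * sphereMoment n l))|
      ≤ ∑ m ∈ Finset.range (d + 1), ∑ l ∈ Finset.range (d + 1),
        K ^ 2 * (d * d * (d ! * d !)) / n := by
        refine (Finset.abs_sum_le_sum_abs _ _).trans (Finset.sum_le_sum fun m hm => ?_)
        refine (Finset.abs_sum_le_sum_abs _ _).trans (Finset.sum_le_sum fun l hl => ?_)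
        rw [Finset.mem_range] at hm hl
        have hm' : m ≤ d := Nat.le_of_lt_succ hm
        have hl' : l ≤ d := Nat.le_of_lt_succ hl
        set c := |pairMoment i k m l - sphereMoment n m * sphereMoment n l| with hc
        have h1 := abs_pairMoment_sub_le hik m l
        have e : p.coeff m * p.coeff l * pairMoment i k m l -
            p.coeff m * sphereMoment n m * (p.coeff l * sphereMoment n l) =
            p.coeff m * p.coeff l *
              (pairMoment i k m l - sphereMoment n m * sphereMoment n l) := by ring
        rw [e, abs_mul, abs_mul, le_div_iff₀ hn, ← hc]
        calc |p.coeff m| * |p.coeff l| * c * n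
            ≤ (K * √n ^ m) * (K * √n ^ l) * c * n := by
              gcongr
              · exact hp _
              · exact hp _
          _ = K ^ 2 * (n * √n ^ (m + l) * c) := by rw [pow_add]; ring
          _ ≤ K ^ 2 * (m * l * (m ! * l !)) := by gcongr
          _ ≤ K ^ 2 * (d * d * (d ! * d !)) := by gcongr
    _ = _ := by simp; ring

end size

/-! ### The fluctuations of the squared gradient -/

section fluctuations

open Polynomial

variable {n : ℕ}

lemma integral_sum_sq (F : Fin n → UnitSphere n → ℝ) (hF : ∀ i, Continuous (F i))
    (b : Fin n → ℝ) :
    ∫ x, (∑ i, b i * F i x) ^ 2 ∂(uniformSphere n) =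
      ∑ i, ∑ k, b i * b k * ∫ x, F i x * F k x ∂(uniformSphere n) := by
  have e : ∀ x, (∑ i, b i * F i x) ^ 2 = ∑ i, ∑ k, b i * b k * (F i x * F k x) := by
    intro x
    rw [pow_two, Finset.sum_mul_sum]
    exact Finset.sum_congr rfl fun i _ => Finset.sum_congr rfl fun k _ => by ring
  simp only [e]
  have hc : ∀ i k, Integrable (fun x => b i * b k * (F i x * F k x)) (uniformSphere n) :=
    fun i k => integrable_uniformSphere (continuous_const.mul ((hF i).mul (hF k)))
  rw [integral_finsetSum _ fun i _ => integrable_finsetSum _ fun k _ => hc i k]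
  refine Finset.sum_congr rfl fun i _ => ?_
  rw [integral_finsetSum _ fun k _ => hc i k]
  exact Finset.sum_congr rfl fun k _ => integral_const_mul _ _

/-- The mean square of a linear combination of odd polynomials in the coordinates. -/
lemma integral_sum_sq_of_odd (hn : 2 ≤ n) {w : ℝ[X]} (hw : ∀ m, Even m → w.coeff m = 0)
    {a : Fin n → ℝ} (ha : ∑ i, a i ^ 2 = 1) :
    ∫ x : UnitSphere n, (∑ i, a i * w.eval ((x : EuclideanSpace ℝ (Fin n)) i)) ^ 2
      ∂(uniformSphere n) = momentFunctional n (w ^ 2) := by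
  rw [integral_sum_sq (fun i (x : UnitSphere n) => w.eval ((x : EuclideanSpace ℝ (Fin n)) i))
    fun i => (continuous_eval_coord w i).comp continuous_subtype_val]
  have e : ∀ i k : Fin n, ∫ x : UnitSphere n, w.eval ((x : EuclideanSpace ℝ (Fin n)) i) *
      w.eval ((x : EuclideanSpace ℝ (Fin n)) k) ∂(uniformSphere n) =
      if i = k then momentFunctional n (w ^ 2) else 0 := by
    intro i k
    split_ifs with h
    · subst h
      simp only [← pow_two, ← eval_pow]
      exact integral_eval hn i _
    · exact integral_eval_mul_eval_of_odd h w w hw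
  simp only [e]
  simp only [mul_ite, mul_zero, Finset.sum_ite_eq, Finset.mem_univ, if_true]
  rw [← Finset.sum_mul]
  simp only [← pow_two, ha, one_mul]

/-- The variance of a linear combination of polynomials in the coordinates. -/
lemma integral_sum_sub_sq_le (hn : 2 ≤ n) {r : ℝ[X]} {b : Fin n → ℝ} (hb : ∀ i, 0 ≤ b i)
    (hb1 : ∑ i, b i = 1) {U V : ℝ} (hV : 0 ≤ V) (hU : momentFunctional n (r ^ 2) ≤ U)
    (hcov : ∀ i k : Fin n, i ≠ k → |∫ x : UnitSphere n,
      r.eval ((x : EuclideanSpace ℝ (Fin n)) i) * r.eval ((x : EuclideanSpace ℝ (Fin n)) k)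
        ∂(uniformSphere n) - momentFunctional n r ^ 2| ≤ V) :
    ∫ x : UnitSphere n, (∑ i, b i * r.eval ((x : EuclideanSpace ℝ (Fin n)) i) -
      momentFunctional n r) ^ 2 ∂(uniformSphere n) ≤ U * ∑ i, b i ^ 2 + V := by
  set m := momentFunctional n r with hm
  have hprob := isProbabilityMeasure_uniformSphere (n := n) (by omega)
  have hc : ∀ i : Fin n, Continuous fun x : UnitSphere n =>
      r.eval ((x : EuclideanSpace ℝ (Fin n)) i) :=
    fun i => (continuous_eval_coord r i).comp continuous_subtype_val
  have e : ∀ x : UnitSphere n, ∑ i, b i * r.eval ((x : EuclideanSpace ℝ (Fin n)) i) - m =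
      ∑ i, b i * (r.eval ((x : EuclideanSpace ℝ (Fin n)) i) - m) := by
    intro x
    simp only [mul_sub, Finset.sum_sub_distrib, ← Finset.sum_mul, hb1, one_mul]
  simp only [e]
  rw [integral_sum_sq (fun i (x : UnitSphere n) => r.eval ((x : EuclideanSpace ℝ (Fin n)) i) - m)
    fun i => (hc i).sub continuous_const]
  have hcv : ∀ i k : Fin n, ∫ x : UnitSphere n, (r.eval ((x : EuclideanSpace ℝ (Fin n)) i) - m) *
      (r.eval ((x : EuclideanSpace ℝ (Fin n)) k) - m) ∂(uniformSphere n) =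
      ∫ x : UnitSphere n, r.eval ((x : EuclideanSpace ℝ (Fin n)) i) *
        r.eval ((x : EuclideanSpace ℝ (Fin n)) k) ∂(uniformSphere n) - m ^ 2 := by
    intro i k
    have hi := hc i
    have hk := hc k
    have e2 : ∀ x : UnitSphere n, (r.eval ((x : EuclideanSpace ℝ (Fin n)) i) - m) *
        (r.eval ((x : EuclideanSpace ℝ (Fin n)) k) - m) =
        r.eval ((x : EuclideanSpace ℝ (Fin n)) i) * r.eval ((x : EuclideanSpace ℝ (Fin n)) k) -
          (m * r.eval ((x : EuclideanSpace ℝ (Fin n)) i) +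
            m * r.eval ((x : EuclideanSpace ℝ (Fin n)) k) - m ^ 2) := fun x => by ring
    simp only [e2]
    rw [integral_sub (integrable_uniformSphere (by fun_prop))
      (integrable_uniformSphere (by fun_prop)), integral_sub (integrable_uniformSphere (by fun_prop))
      (integrable_uniformSphere (by fun_prop)), integral_add (integrable_uniformSphere (by fun_prop))
      (integrable_uniformSphere (by fun_prop)), integral_const_mul, integral_const_mul,
      integral_eval hn, integral_eval hn, integral_const, probReal_univ, ← hm, one_smul]
    ring
  -- Allowing `V` for all pairs, diagonal included, sums to `V (∑ b_i)² = V`; on the diagonal `m²`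
  -- is discarded.
  have hterm : ∀ i k : Fin n, b i * b k * ∫ x : UnitSphere n,
      (r.eval ((x : EuclideanSpace ℝ (Fin n)) i) - m) *
      (r.eval ((x : EuclideanSpace ℝ (Fin n)) k) - m) ∂(uniformSphere n) ≤
      (if i = k then U * (b i * b k) else 0) + V * (b i * b k) := by
    intro i k
    have hbb : 0 ≤ b i * b k := mul_nonneg (hb i) (hb k)
    rw [hcv]
    split_ifs with h
    · subst h
      have : ∫ x : UnitSphere n, r.eval ((x : EuclideanSpace ℝ (Fin n)) i) *
          r.eval ((x : EuclideanSpace ℝ (Fin n)) i) ∂(uniformSphere n) ≤ U := by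
        simp only [← pow_two, ← eval_pow]
        rwa [integral_eval hn]
      nlinarith [mul_nonneg hV hbb, mul_nonneg hbb (sq_nonneg m)]
    · have := (abs_le.mp (hcov i k h)).2
      nlinarith
  refine (Finset.sum_le_sum fun i _ => Finset.sum_le_sum fun k _ => hterm i k).trans_eq ?_
  simp only [Finset.sum_add_distrib, Finset.sum_ite_eq, Finset.mem_univ, if_true,
    ← Finset.mul_sum, hb1, mul_one, ← pow_two]

/-- Cauchy-Schwarz; it lets errors without a factor of `a` be absorbed into `‖a‖₄`. -/
lemma one_le_mul_sum_pow_four {a : Fin n → ℝ} (ha : ∑ i, a i ^ 2 = 1) :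
    1 ≤ n * ∑ i, a i ^ 4 := by
  have h := sq_sum_le_card_mul_sum_sq (s := Finset.univ) (f := fun i => a i ^ 2)
  rw [ha, Finset.card_univ, Fintype.card_fin] at h
  simpa [← pow_mul] using h

lemma norm4_sq (a : Fin n → ℝ) : norm4 a ^ 2 = √(∑ i, a i ^ 4) := by
  have e : ∀ i, |a i| ^ 4 = a i ^ 4 := fun i => Even.pow_abs (by decide) _
  rw [norm4, ← Real.rpow_natCast, ← Real.rpow_mul (by positivity), Real.sqrt_eq_rpow]
  simp only [e]
  norm_num

/-- Uniform bounds for the polynomials that make up the squared gradient. -/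
lemma exists_gradient_bounds (ℓ : ℕ) : ∃ B : ℝ, 0 ≤ B ∧ ∀ n : ℕ, 3 ≤ n →
    momentFunctional n ((X * derivative (zonalPoly n ℓ)) ^ 2) ≤ B ∧
    momentFunctional n ((derivative (zonalPoly n ℓ) ^ 2) ^ 2) ≤ B * n ^ 2 ∧
    ∀ i k : Fin n, i ≠ k → |∫ x : UnitSphere n,
      (derivative (zonalPoly n ℓ) ^ 2).eval ((x : EuclideanSpace ℝ (Fin n)) i) *
        (derivative (zonalPoly n ℓ) ^ 2).eval ((x : EuclideanSpace ℝ (Fin n)) k)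
        ∂(uniformSphere n) - momentFunctional n (derivative (zonalPoly n ℓ) ^ 2) ^ 2| ≤ B * n := by
  obtain ⟨K, hK, hcoeff⟩ := exists_abs_coeff_zonalPoly_le ℓ
  set d := 4 * ℓ + 2 with hd
  set L := ((d : ℝ) + 1) * (ℓ * K * (ℓ * K)) with hL
  have hL0 : 0 ≤ L := by positivity
  set B₁ := ((d : ℝ) + 1) * d ! * L with hB₁
  set B₂ := ((d : ℝ) + 1) * d ! * ((d + 1) * (L * L)) with hB₂
  set B₃ := ((d : ℝ) + 1) ^ 2 * (d * d * (d ! * d !)) * L ^ 2 with hB₃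
  have h1 : 0 ≤ B₁ := by positivity
  have h2 : 0 ≤ B₂ := by positivity
  have h3 : 0 ≤ B₃ := by positivity
  refine ⟨B₁ + B₂ + B₃, by positivity, fun n hn => ?_⟩
  have hn0 : (0 : ℝ) < n := by exact_mod_cast (by omega : 0 < n)
  have hs : 0 ≤ √(n : ℝ) := Real.sqrt_nonneg _
  have hss : √(n : ℝ) * √(n : ℝ) = n := Real.mul_self_sqrt hn0.le
  set q := zonalPoly n ℓ with hq
  have hdq : q.natDegree ≤ ℓ := natDegree_zonalPoly_le n ℓ
  have hdq' : (derivative q).natDegree ≤ ℓ := (natDegree_derivative_le q).trans (by omega)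
  have hdXq : (X * derivative q).natDegree ≤ ℓ + 1 :=
    natDegree_mul_le.trans (by rw [natDegree_X]; omega)
  have hdr : (derivative q ^ 2).natDegree ≤ 2 * ℓ :=
    natDegree_pow_le.trans (by omega)
  have hc1 := abs_coeff_derivative_le hs hK hdq (hcoeff n hn)
  have hcX := abs_coeff_X_mul_derivative_le hs hK hdq (hcoeff n hn)
  have hcr : ∀ m, |(derivative q ^ 2).coeff m| ≤ (L * n) * √(n : ℝ) ^ m := by
    intro m
    rw [pow_two]
    refine (abs_coeff_mul_le hs (by positivity) (by positivity) (d := d)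
      (by rw [← pow_two]; omega) hc1 hc1 m).trans_eq ?_
    rw [hL]
    linear_combination ((d : ℝ) + 1) * (ℓ * K * (ℓ * K)) * √(n : ℝ) ^ m * hss
  have hcXX : ∀ m, |((X * derivative q) ^ 2).coeff m| ≤ L * √(n : ℝ) ^ m := by
    intro m
    rw [pow_two]
    exact abs_coeff_mul_le hs (by positivity) (by positivity) (d := d)
      (natDegree_mul_le.trans (by omega)) hcX hcX m
  have hcrr : ∀ m, |((derivative q ^ 2) ^ 2).coeff m| ≤
      (((d : ℝ) + 1) * ((L * n) * (L * n))) * √(n : ℝ) ^ m := by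
    intro m
    rw [pow_two (derivative q ^ 2)]
    exact abs_coeff_mul_le hs (by positivity) (by positivity) (d := d)
      (natDegree_mul_le.trans (by omega)) hcr hcr m
  refine ⟨?_, ?_, fun i k hik => ?_⟩
  · refine (le_abs_self _).trans ((abs_momentFunctional_le hn0 hL0 (d := d)
      (natDegree_pow_le.trans (by omega)) hcXX).trans ?_)
    linarith
  · refine (le_abs_self _).trans ((abs_momentFunctional_le hn0 (by positivity) (d := d)
      (natDegree_pow_le.trans (by omega)) hcrr).trans ?_)
    have : ((d : ℝ) + 1) * d ! * ((d + 1) * ((L * n) * (L * n))) = B₂ * n ^ 2 := by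
      rw [hB₂]; ring
    rw [this]
    gcongr
    linarith
  · refine (abs_covariance_eval_le hik (by positivity) (d := d) (by omega) hcr).trans ?_
    have : ((d : ℝ) + 1) ^ 2 * (d * d * (d ! * d !)) * (L * n) ^ 2 / n = B₃ * n := by
      rw [hB₃]; field_simp
    rw [this]
    gcongr
    linarith

lemma coeff_X_mul_derivative_zonalPoly_of_even (n : ℕ) {ℓ m : ℕ} (hℓ : Odd ℓ) (hm : Even m) :
    (X * derivative (zonalPoly n ℓ)).coeff m = 0 := by
  rcases m with _ | m
  · simp
  · rw [coeff_X_mul, coeff_derivative, coeff_zonalPoly_of_even n hℓ hm, zero_mul]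

/-- The squared gradient is `G₁ - G₂`, with `G₁` concentrated around its mean and `G₂ ≥ 0` of
bounded mean. -/
lemma exists_integral_abs_sub_gradSq_le {ℓ : ℕ} (hℓ : Odd ℓ) : ∃ B : ℝ, 0 ≤ B ∧ ∀ n : ℕ, 3 ≤ n →
    ∀ a : Fin n → ℝ, ∑ i, a i ^ 2 = 1 →
      ∫ x : UnitSphere n, |ℓ * ((n : ℝ) + ℓ - 2) - gradSq (zonalPoly n ℓ) a x|
        ∂(uniformSphere n) ≤ B * (n * norm4 a ^ 2) := by
  obtain ⟨B, hB, hbounds⟩ := exists_gradient_bounds ℓ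
  refine ⟨√(2 * B) + 2 * B, by positivity, fun n hn a ha => ?_⟩
  obtain ⟨hX, hr2, hcov⟩ := hbounds n hn
  have hn0 : (0 : ℝ) < n := by exact_mod_cast (by omega : 0 < n)
  have hn1 : (1 : ℝ) ≤ n := by exact_mod_cast (by omega : 1 ≤ n)
  have hprob := isProbabilityMeasure_uniformSphere (n := n) (by omega)
  set μ : ℝ := ℓ * ((n : ℝ) + ℓ - 2) with hμ
  set q := zonalPoly n ℓ with hq
  set r := derivative q ^ 2 with hr
  set w := X * derivative q with hw
  set S := ∑ i, a i ^ 4 with hS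
  have hS0 : 0 ≤ S := Finset.sum_nonneg fun i _ => by positivity
  have hS1 : 1 ≤ n * S := one_le_mul_sum_pow_four ha
  set G₁ : UnitSphere n → ℝ := fun x => ∑ i, a i ^ 2 * r.eval ((x : EuclideanSpace ℝ (Fin n)) i)
    with hG₁
  set G₂ : UnitSphere n → ℝ := fun x =>
    (∑ i, a i * w.eval ((x : EuclideanSpace ℝ (Fin n)) i)) ^ 2 with hG₂
  have hr_c := fun i : Fin n => (continuous_eval_coord r i).comp
    (continuous_subtype_val (p := fun x => x ∈ Metric.sphere (0 : EuclideanSpace ℝ (Fin n)) 1))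
  have hw_c := fun i : Fin n => (continuous_eval_coord w i).comp
    (continuous_subtype_val (p := fun x => x ∈ Metric.sphere (0 : EuclideanSpace ℝ (Fin n)) 1))
  have hG₁c : Continuous G₁ := continuous_finsetSum _ fun i _ => continuous_const.mul (hr_c i)
  have hG₂c : Continuous G₂ :=
    (continuous_finsetSum _ fun i _ => continuous_const.mul (hw_c i)).pow 2
  have hgrad : ∀ x : UnitSphere n, gradSq q a x = G₁ x - G₂ x := by
    intro x
    simp [gradSq, hG₁, hG₂, hr, hw]
  have hE2 : ∫ x, G₂ x ∂(uniformSphere n) = momentFunctional n (w ^ 2) :=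
    integral_sum_sq_of_odd (by omega) (fun m hm =>
      coeff_X_mul_derivative_zonalPoly_of_even n hℓ hm) ha
  have hX0 : 0 ≤ momentFunctional n (w ^ 2) := by
    rw [← hE2]
    exact integral_nonneg fun x => sq_nonneg _
  -- The energy identity, as `q'² - (X q')² = (1 - X²) q'²` and `q` has norm one.
  have henergy : momentFunctional n r - momentFunctional n (w ^ 2) = μ := by
    have h := momentFunctional_energy hn0 (zonalPoly_ode hn ℓ)
    rw [momentFunctional_zonalPoly_sq hn, mul_one, ← hq] at h
    rw [← map_sub, hμ, ← h]
    congr 1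
    rw [hr, hw]
    ring
  have hVar : ∫ x, (G₁ x - momentFunctional n r) ^ 2 ∂(uniformSphere n) ≤ 2 * B * (n ^ 2 * S) := by
    refine (integral_sum_sub_sq_le (by omega) (fun i => sq_nonneg (a i)) ha
      (by positivity : 0 ≤ B * n) hr2 hcov).trans ?_
    have e : ∑ i, (a i ^ 2) ^ 2 = S := Finset.sum_congr rfl fun i _ => by ring
    rw [e]
    have : B * n * 1 ≤ B * n * (n * S) := by gcongr
    nlinarith
  have hL1 : ∫ x, |G₁ x - momentFunctional n r| ∂(uniformSphere n) ≤ √(2 * B) * (n * √S) := by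
    have hcabs : Continuous fun x => |G₁ x - momentFunctional n r| := by fun_prop
    have hsq : (∫ x, |G₁ x - momentFunctional n r| ∂(uniformSphere n)) ^ 2 ≤
        ∫ x, (G₁ x - momentFunctional n r) ^ 2 ∂(uniformSphere n) := by
      have := (convexOn_pow 2).map_integral_le (continuous_pow 2).continuousOn isClosed_Ici
        (Filter.Eventually.of_forall fun x => abs_nonneg (G₁ x - momentFunctional n r))
        (integrable_uniformSphere hcabs)
        (integrable_uniformSphere (hcabs.pow 2))
      simpa [Function.comp_def] using this
    have e : √(2 * B) * (n * √S) = √(2 * B * (n ^ 2 * S)) := by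
      rw [Real.sqrt_mul (by positivity) (_ * _), Real.sqrt_mul (by positivity) S,
        Real.sqrt_sq hn0.le]
    rw [e]
    exact Real.le_sqrt_of_sq_le (hsq.trans hVar)
  rw [norm4_sq, ← hS]
  have hone : 1 ≤ n * √S := by
    have h1 : √(n * S) ≤ n * √S := by
      rw [Real.sqrt_mul hn0.le]
      gcongr
      exact Real.sqrt_le_iff.mpr ⟨hn0.le, by nlinarith⟩
    exact (Real.one_le_sqrt.mpr hS1).trans h1
  calc ∫ x : UnitSphere n, |μ - gradSq q a x| ∂(uniformSphere n)
      ≤ ∫ x : UnitSphere n, (|G₁ x - momentFunctional n r| + momentFunctional n (w ^ 2) + G₂ x)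
          ∂(uniformSphere n) := by
        refine integral_mono (integrable_uniformSphere ?_) (integrable_uniformSphere
          (by fun_prop)) fun x => ?_
        · have := (continuous_gradSq q a).comp
            (continuous_subtype_val
              (p := fun x => x ∈ Metric.sphere (0 : EuclideanSpace ℝ (Fin n)) 1))
          exact (continuous_const.sub this).abs
        · have e : μ - gradSq q a x =
              -(G₁ x - momentFunctional n r) - momentFunctional n (w ^ 2) + G₂ x := by
            rw [hgrad, ← henergy]; ring
          have hG0 : 0 ≤ G₂ x := sq_nonneg _
          simp only
          rw [e]
          refine (abs_add_le _ _).trans ?_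
          rw [abs_of_nonneg hG0]
          gcongr
          refine (abs_sub _ _).trans ?_
          rw [abs_neg, abs_of_nonneg hX0]
    _ = ∫ x, |G₁ x - momentFunctional n r| ∂(uniformSphere n) +
          2 * momentFunctional n (w ^ 2) := by
        rw [integral_add (integrable_uniformSphere (by fun_prop))
          (integrable_uniformSphere hG₂c), integral_add (integrable_uniformSphere (by fun_prop))
          (integrable_uniformSphere (by fun_prop)), hE2, integral_const, probReal_univ, one_smul]
        ring
    _ ≤ √(2 * B) * (n * √S) + 2 * B * (n * √S) := by
        have : 2 * B * 1 ≤ 2 * B * (n * √S) := by gcongr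
        linarith
    _ = _ := by ring

lemma exists_zonalTV_le {ℓ : ℕ} (hℓ : Odd ℓ) : ∃ c : ℝ, 0 ≤ c ∧ ∀ n : ℕ, 3 ≤ n →
    ∀ a : Fin n → ℝ, ∑ i, a i ^ 2 = 1 → zonalTV n ℓ a ≤ c * norm4 a ^ 2 := by
  obtain ⟨B, hB, h⟩ := exists_integral_abs_sub_gradSq_le hℓ
  refine ⟨4 * B, by positivity, fun n hn a ha => ?_⟩
  have hn3 : (3 : ℝ) ≤ n := by exact_mod_cast hn
  have hℓ1 : (1 : ℝ) ≤ ℓ := by exact_mod_cast hℓ.pos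
  -- Since `ℓ ≥ 1`, the eigenvalue is at least `n - 1`; the factor `2/μ ≤ 4/n` then gives `4 * B`.
  have hμ : (n : ℝ) / 2 ≤ ℓ * ((n : ℝ) + ℓ - 2) := by nlinarith
  have hμ0 : 0 < ℓ * ((n : ℝ) + ℓ - 2) := by linarith
  have hN : 0 ≤ B * (n * norm4 a ^ 2) := by positivity
  calc zonalTV n ℓ a ≤ 2 / (ℓ * ((n : ℝ) + ℓ - 2)) * (B * (n * norm4 a ^ 2)) :=
        (zonalTV_le_integral_gradSq hn rfl hμ0 a).trans
          (mul_le_mul_of_nonneg_left (h n hn a ha) (by positivity))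
    _ ≤ 2 / ((n : ℝ) / 2) * (B * (n * norm4 a ^ 2)) := by gcongr
    _ = 4 * B * norm4 a ^ 2 := by field_simp; ring

end fluctuations

/-! ### Random coefficients -/

section randomCoefficients

open Polynomial

variable {n : ℕ}

/-- For each Borel set the law's value is the measure of a section of a measurable set in the
product of two spheres. -/
lemma measurable_zonalTV (hn : 0 < n) (ℓ : ℕ) :
    Measurable fun a : UnitSphere n => zonalTV n ℓ fun i => (a : EuclideanSpace ℝ (Fin n)) i := by
  have := fun a : UnitSphere n => isProbabilityMeasure_map_zonalCombination hn ℓ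
    fun i => (a : EuclideanSpace ℝ (Fin n)) i
  refine measurable_tvDist fun A hA => ?_
  have hc : Continuous fun p : UnitSphere n × UnitSphere n =>
      zonalCombination n ℓ (fun i => (p.1 : EuclideanSpace ℝ (Fin n)) i) p.2 :=
    (continuous_zonalCombination_uncurry ℓ).comp
      (f := fun p : UnitSphere n × UnitSphere n =>
        ((fun i => (p.1 : EuclideanSpace ℝ (Fin n)) i : Fin n → ℝ), p.2)) (by fun_prop)
  have hm := measurable_measure_prodMk_left (ν := uniformSphere n) (hc.measurable hA)
  convert! hm.ennreal_toReal using 2 with a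
  rw [Measure.real, Measure.map_apply (continuous_zonalCombination ℓ _).measurable hA]
  rfl

lemma zonalTV_le_one (hn : 0 < n) (ℓ : ℕ) (a : Fin n → ℝ) : zonalTV n ℓ a ≤ 1 := by
  have := isProbabilityMeasure_map_zonalCombination hn ℓ a
  refine tvDist_le_of_continuous fun h hc h0 h1 => ?_
  have key : ∀ κ : Measure ℝ, IsProbabilityMeasure κ → 0 ≤ ∫ x, h x ∂κ ∧ ∫ x, h x ∂κ ≤ 1 := by
    intro κ _
    refine ⟨integral_nonneg h0, ?_⟩
    have hi : Integrable h κ := (integrable_const (1 : ℝ)).mono' hc.aestronglyMeasurable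
      (Filter.Eventually.of_forall fun x => by rw [Real.norm_of_nonneg (h0 x)]; exact h1 x)
    simpa using integral_mono hi (integrable_const (1 : ℝ)) h1
  have h2 := key _ this
  have h3 := key (gaussianReal 0 1) inferInstance
  exact abs_le.mpr ⟨by linarith, by linarith⟩

/-- Without integrability the mean would be `0` by default and the third claim empty. -/
lemma integrable_zonalTV (hn : 0 < n) (ℓ : ℕ) :
    Integrable (fun a : UnitSphere n => zonalTV n ℓ fun i => (a : EuclideanSpace ℝ (Fin n)) i)
      (uniformSphere n) :=
  (integrable_const (1 : ℝ)).mono' (measurable_zonalTV hn ℓ).aestronglyMeasurable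
    (Filter.Eventually.of_forall fun _ => by
      rw [zonalTV, Real.norm_of_nonneg (tvDist_nonneg _ _)]
      exact zonalTV_le_one hn ℓ _)

lemma integral_sum_pow_four_le (hn : 2 ≤ n) :
    ∫ a : UnitSphere n, ∑ i, (a : EuclideanSpace ℝ (Fin n)) i ^ 4 ∂(uniformSphere n) ≤ 3 / n := by
  have hn0 : (0 : ℝ) < n := by exact_mod_cast (by omega : 0 < n)
  have h4 : ∀ i : Fin n, ∫ a : UnitSphere n, (a : EuclideanSpace ℝ (Fin n)) i ^ 4
      ∂(uniformSphere n) = 3 / ((n + 2) * n) := by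
    intro i
    have h := integral_eval hn i (X ^ 4)
    simp only [eval_pow, eval_X] at h
    rw [h, X_pow_eq_monomial, momentFunctional_monomial]
    simp [sphereMoment]
    field_simp
    ring
  rw [integral_finsetSum _ fun i _ => integrable_uniformSphere_coe (f := fun x => x i ^ 4)
    (by fun_prop)]
  simp only [h4, Finset.sum_const, Finset.card_univ, Fintype.card_fin, nsmul_eq_mul]
  have : (n : ℝ) * (3 / ((n + 2) * n)) = 3 / (n + 2) := by field_simp
  rw [this]
  gcongr
  linarith

lemma integral_norm4_sq_le (hn : 2 ≤ n) :
    ∫ a : UnitSphere n, norm4 (fun i => (a : EuclideanSpace ℝ (Fin n)) i) ^ 2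
      ∂(uniformSphere n) ≤ 2 / √n := by
  have hn0 : (0 : ℝ) < n := by exact_mod_cast (by omega : 0 < n)
  have hprob := isProbabilityMeasure_uniformSphere (n := n) (by omega)
  have hs : 0 < √(n : ℝ) := Real.sqrt_pos.mpr hn0
  simp only [norm4_sq]
  -- The tangent line of the square root at `1/n`, in place of Jensen; with mean at most `3/n` it
  -- gives `3/(2√n) + 1/(2√n) = 2/√n`.
  have hle : ∀ S : ℝ, 0 ≤ S → √S ≤ √n / 2 * S + 1 / (2 * √n) := by
    intro S hS
    have h1 := Real.sq_sqrt hS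
    have h2 : √n / 2 * S + 1 / (2 * √n) - √S = (√n * √S - 1) ^ 2 / (2 * √n) := by
      field_simp
      linear_combination -(√(n : ℝ) ^ 2) * h1
    have : 0 ≤ (√n * √S - 1) ^ 2 / (2 * √n) := by positivity
    linarith
  have hc : Continuous fun a : UnitSphere n => ∑ i, (a : EuclideanSpace ℝ (Fin n)) i ^ 4 := by
    fun_prop
  calc ∫ a : UnitSphere n, √(∑ i, (a : EuclideanSpace ℝ (Fin n)) i ^ 4) ∂(uniformSphere n)
      ≤ ∫ a : UnitSphere n, (√n / 2 * ∑ i, (a : EuclideanSpace ℝ (Fin n)) i ^ 4 +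
          1 / (2 * √n)) ∂(uniformSphere n) :=
        integral_mono (integrable_uniformSphere hc.sqrt)
          (integrable_uniformSphere ((continuous_const.mul hc).add continuous_const)) fun a =>
          hle _ (Finset.sum_nonneg fun i _ => by positivity)
    _ = √n / 2 * (∫ a : UnitSphere n, ∑ i, (a : EuclideanSpace ℝ (Fin n)) i ^ 4
          ∂(uniformSphere n)) + 1 / (2 * √n) := by
        rw [integral_add (integrable_uniformSphere (by fun_prop))
          (integrable_const _), integral_const_mul, integral_const, probReal_univ, one_smul]
    _ ≤ √n / 2 * (3 / n) + 1 / (2 * √n) := by gcongr; exact integral_sum_pow_four_le hn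
    _ = 2 / √n := by
        have h := Real.sq_sqrt hn0.le
        field_simp
        rw [h]
        ring

end randomCoefficients

end

/-! ### Combination of the bounds for fixed and random coefficients. -/

theorem mainTheorem4 (ℓ : ℕ) (hℓ : Odd ℓ) :
    ∃ c c' : ℝ, ∀ n : ℕ, 3 ≤ n →
      (∀ k : Fin n, IsSphereEigenfunction ℓ (zonalHarmonic n ℓ k)) ∧
      (∀ i j : Fin n,
        ∫ x, zonalHarmonic n ℓ i x * zonalHarmonic n ℓ j x ∂(uniformSphere n) =
          if i = j then 1 else 0) ∧
      (∀ a : Fin n → ℝ, ∑ i, a i ^ 2 = 1 → zonalTV n ℓ a ≤ c * norm4 a ^ 2) ∧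
      Integrable
        (fun a : UnitSphere n => zonalTV n ℓ (fun i => (a : EuclideanSpace ℝ (Fin n)) i))
        (uniformSphere n) ∧
      ∫ a : UnitSphere n, zonalTV n ℓ (fun i => (a : EuclideanSpace ℝ (Fin n)) i)
        ∂(uniformSphere n) ≤ c' / Real.sqrt n := by
  obtain ⟨c, hc0, hc⟩ := exists_zonalTV_le hℓ
  refine ⟨c, 2 * c, fun n hn => ⟨isSphereEigenfunction_zonalHarmonic hℓ hn,
    integral_zonalHarmonic_mul hℓ hn, hc n hn, integrable_zonalTV (by omega) ℓ, ?_⟩⟩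
  have hcont : Continuous fun a : UnitSphere n =>
      norm4 (fun i => (a : EuclideanSpace ℝ (Fin n)) i) ^ 2 := by
    simp only [norm4_sq]
    fun_prop
  calc ∫ a : UnitSphere n, zonalTV n ℓ (fun i => (a : EuclideanSpace ℝ (Fin n)) i)
        ∂(uniformSphere n)
      ≤ ∫ a : UnitSphere n, c * norm4 (fun i => (a : EuclideanSpace ℝ (Fin n)) i) ^ 2
        ∂(uniformSphere n) :=
        integral_mono (integrable_zonalTV (by omega) ℓ)
          (integrable_uniformSphere (continuous_const.mul hcont)) fun a =>
          hc n hn _ (sum_sq_sphere a)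
    _ = c * ∫ a : UnitSphere n, norm4 (fun i => (a : EuclideanSpace ℝ (Fin n)) i) ^ 2
        ∂(uniformSphere n) := integral_const_mul _ _
    _ ≤ c * (2 / √n) := by gcongr; exact integral_norm4_sq_le (by omega)
    _ = 2 * c / √n := by ring
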